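/- **Hybrid systems.** A hybrid system has a finite set $L$ of locations, $n$ real variables, a finite set $E$ of edges (each with a source and a target location), and, for each location $\ell$, a continuous flow $\gamma_\ell:\mathbb R^n\times\mathbb R^+\to\mathbb R^n$ and an invariant $\mathrm{Inv}(\ell)\subseteq\mathbb R^n$; each edge $e$ has a guard $\mathcal G(e)\subseteq\mathbb R^n$ and, for each $v\in\mathbb R^n$, a reset set $\mathcal R_e(v)\subseteq\mathbb R^n$. An edge $e$ from $\ell$ to $\ell'$ is enabled at the state $(\ell,v)$ if $v\in\mathrm{Inv}(\ell)\cap\mathcal G(e)$ and $\mathcal R_e(v)\cap\mathrm{Inv}(\ell')\neq\emptyset$. For a state $s=(\ell,v)$ write $s+\tau=(\ell,\gamma_\ell(v,\tau))$ and let $I(s)$ be the set of $\tau\ge 0$ such that $\gamma_\ell(v,\tau')\in \mathrm{Inv}(\ell)$ for all $0\le\tau'\le\tau$ and some edge is enabled at $s+\tau$. **Stochastic hybrid systems.** A stochastic hybrid system (SHS) is a hybrid system with Borel guards, invariants and resets, together with (measurable families of) a probability distribution $\mu_s$ on $\mathbb R^+$ with $\mu_s(I(s))=1$ for every state $s$;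 a probability distribution $\eta_e(v)$ on $\mathcal R_e(v)$ for every edge $e$ and $v\in\mathbb R^n$; and, for every state $s$ at which some edge is enabled, a probability distribution $p_s$ on $E$ with $p_s(e)>0$ if and only if $e$ is enabled at $s$. It induces the Markov kernel on $L\times\mathbb R^n$ $$\kappa(s,B)=\int \sum_{e=(\ell\to\ell')}p_{s+\tau}(e)\,\eta_e(\gamma_\ell(v,\tau))\big(\{v'' : (\ell',v'')\in B\}\big)\,d\mu_s(\tau),\qquad s=(\ell,v).$$ For an initial distribution $\mu$ and a measurable set $B$ of states, $\mathrm{Prob}_\mu(\mathbf F B)$ is the probability that the Markov chain with kernel $\kappa$ and initial distribution $\mu$ eventually visits $B$. **Inputs.** Consider the following finitely described inputs: an SHS with trivial invariants ($\mathrm{Inv}(\ell)=\mathbb R^n$) in which * the delay in each location is uniformly distributed on a bounded interval with integer endpoints $0\le a<b$ attached to the location (so the delay distribution is absolutely continuous at every state); * each guard is a single linear comparison $\sum_i a_i x_i<c$ or $\sum_i a_i x_i\le c$ with integers $a_i,c$; * in each location every variable grows with a constant positive integer slope; * each edge deterministically resets some variables to $0$ and leaves the others unchanged; * the edge is chosen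 uniformly among the enabled ones; together with an initial state with integer values (the initial distribution $\mu$ is the Dirac measure there) and a target location, $B$ being the set of all states in that location. **Proposition (Undecidability of SHSs).** Already for these inputs, each of the following problems is undecidable, in the sense that there is no algorithm that halts with a correct answer on every input: 1. deciding whether $\mathrm{Prob}_\mu(\mathbf F B)=1$; 2. deciding whether $\mathrm{Prob}_\mu(\mathbf F B)=0$; 3. given in addition rationals $\varepsilon>0$ and $p$, deciding whether $|\mathrm{Prob}_\mu(\mathbf F B)-p|<\varepsilon$; 4. for any fixed real $\varepsilon$ with $0<\varepsilon<\tfrac12$: given in addition a rational $p$, deciding whether $|\mathrm{Prob}_\mu(\mathbf F B)-p|<\varepsilon$; 5. for any fixed real $\varepsilon$ with $0<\varepsilon<\tfrac12$: computing a rational number $q$ with $|\mathrm{Prob}_\mu(\mathbf F B)-q|\le\varepsilon$. Consequently all these problems are undecidable for SHSs with purely continuous delay distributions, guards that are linear comparisons of variables and constants, and positive integer slopes. -/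

import Mathlib

open MeasureTheory ProbabilityTheory
open scoped NNReal ENNReal

noncomputable section

/-! ## Stochastic transition systems -/

/-- One step of the stochastic transition system `κ`, as a kernel from histories
`s₀ … s_k` to the next state: it looks at the last state only. -/
def historyKernel {S : Type*} [MeasurableSpace S] (κ : Kernel S S) (k : ℕ) :
    Kernel (Π _ : Finset.Iic k, S) S :=
  κ.comap (fun h => h ⟨k, Finset.mem_Iic.2 le_rfl⟩) (measurable_pi_apply _)

instance {S : Type*} [MeasurableSpace S] (κ : Kernel S S) [IsMarkovKernel κ] (k : ℕ) :
    IsMarkovKernel (historyKernel κ k) := by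
  unfold historyKernel; infer_instance

/-- The probability measure on the runs `s₀ s₁ s₂ …` of the stochastic transition system `κ`
started from the initial distribution `μ` (Ionescu-Tulcea). -/
def runMeasure {S : Type*} [MeasurableSpace S] (κ : Kernel S S) [IsMarkovKernel κ]
    (μ : Measure S) : Measure (ℕ → S) :=
  (μ.map (fun s (_ : Finset.Iic 0) => s)).bind
    (Kernel.traj (X := fun _ => S) (historyKernel κ) 0)

/-- The runs that visit `B` at some point. -/
def eventually {S : Type*} (B : Set S) : Set (ℕ → S) := {ω | ∃ k, ω k ∈ B}

/-- The probability, from the initial distribution `μ`, of eventually visiting `B`. -/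
def reachProb {S : Type*} [MeasurableSpace S] (κ : Kernel S S) [IsMarkovKernel κ]
    (μ : Measure S) (B : Set S) : ℝ :=
  (runMeasure κ μ).real (eventually B)

/-! ## Hybrid systems -/

/-- A hybrid system with locations `L`, edges `E` (each edge carrying its own event) and `n`
continuous variables. -/
structure HybridSystem (L E : Type) (n : ℕ) where
  src : E → L
  tgt : E → L
  flow : L → (Fin n → ℝ) → ℝ≥0 → (Fin n → ℝ)
  continuous_flow : ∀ l, Continuous fun p : (Fin n → ℝ) × ℝ≥0 => flow l p.1 p.2
  inv : L → Set (Fin n → ℝ)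
  guard : E → Set (Fin n → ℝ)
  reset : E → (Fin n → ℝ) → Set (Fin n → ℝ)

namespace HybridSystem

variable {L E : Type} {n : ℕ} (H : HybridSystem L E n)

/-- The switch-transition `s →[e] s'`. -/
def Switch (s : L × (Fin n → ℝ)) (e : E) (s' : L × (Fin n → ℝ)) : Prop :=
  s.1 = H.src e ∧ s'.1 = H.tgt e ∧ s.2 ∈ H.inv s.1 ∩ H.guard e ∧
    s'.2 ∈ H.reset e s.2 ∩ H.inv s'.1

/-- The state `s + τ`. -/
def after (s : L × (Fin n → ℝ)) (τ : ℝ≥0) : L × (Fin n → ℝ) := (s.1, H.flow s.1 s.2 τ)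

/-- The delay-transition `s →[τ] s'`. -/
def Delay (s : L × (Fin n → ℝ)) (τ : ℝ≥0) (s' : L × (Fin n → ℝ)) : Prop :=
  (∀ τ' ≤ τ, H.flow s.1 s.2 τ' ∈ H.inv s.1) ∧ s' = H.after s τ

/-- The mixed transition `s →[τ, e] s'`. -/
def Mixed (s : L × (Fin n → ℝ)) (τ : ℝ≥0) (e : E) (s' : L × (Fin n → ℝ)) : Prop :=
  ∃ s'', H.Delay s τ s'' ∧ H.Switch s'' e s'

/-- Edge `e` is enabled at state `s`. -/
def Enabled (s : L × (Fin n → ℝ)) (e : E) : Prop := ∃ s', H.Switch s e s'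

/-- The set `I(s)` of delays after which some edge is enabled from `s`. -/
def allowedDelays (s : L × (Fin n → ℝ)) : Set ℝ≥0 := {τ | ∃ e s', H.Mixed s τ e s'}

end HybridSystem

/-! ## Stochastic hybrid systems -/

/-- A stochastic hybrid system. -/
structure StochHybridSystem (L E : Type) [Finite L] [MeasurableSpace L]
    [DiscreteMeasurableSpace L] [Fintype E] (n : ℕ) extends HybridSystem L E n where
  measurableSet_inv : ∀ l, MeasurableSet (inv l)
  measurableSet_guard : ∀ e, MeasurableSet (guard e)
  measurableSet_reset : ∀ e v, MeasurableSet (reset e v)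
  /-- the distribution of the delay at each state -/
  delayDist : Kernel (L × (Fin n → ℝ)) ℝ≥0
  isMarkov_delayDist : IsMarkovKernel delayDist
  delayDist_allowed : ∀ s, ∀ᵐ τ ∂delayDist s, τ ∈ toHybridSystem.allowedDelays s
  /-- the distribution of the new valuation, for each edge and valuation -/
  resetDist : E → Kernel (Fin n → ℝ) (Fin n → ℝ)
  isMarkov_resetDist : ∀ e, IsMarkovKernel (resetDist e)
  resetDist_reset : ∀ e v, ∀ᵐ v' ∂resetDist e v, v' ∈ reset e v
  /-- the probability of each edge at each state (it vanishes identically at the states where no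
  edge is enabled, where the distribution on edges is not defined) -/
  edgeProb : L × (Fin n → ℝ) → E → ℝ≥0∞
  measurable_edgeProb : ∀ e, Measurable fun s => edgeProb s e
  edgeProb_pos_iff : ∀ s e, 0 < edgeProb s e ↔ toHybridSystem.Enabled s e
  sum_edgeProb : ∀ s, (∃ e, toHybridSystem.Enabled s e) → ∑ e, edgeProb s e = 1

namespace StochHybridSystem

variable {L E : Type} [Finite L] [MeasurableSpace L] [DiscreteMeasurableSpace L] [Fintype E]
  {n : ℕ} (H : StochHybridSystem L E n)

instance : IsMarkovKernel H.delayDist := H.isMarkov_delayDist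

instance (e : E) : IsMarkovKernel (H.resetDist e) := H.isMarkov_resetDist e

theorem measurable_after :
    Measurable fun p : (L × (Fin n → ℝ)) × ℝ≥0 => H.after p.1 p.2 := by
  have h : Measurable fun q : L × ((Fin n → ℝ) × ℝ≥0) => H.flow q.1 q.2.1 q.2.2 :=
    measurable_from_prod_countable_right fun l => (H.continuous_flow l).measurable
  refine Measurable.prodMk (measurable_fst.comp measurable_fst) ?_
  exact h.comp (by fun_prop :
    Measurable fun p : (L × (Fin n → ℝ)) × ℝ≥0 => (p.1.1, (p.1.2, p.2)))

/-- The law of the next state, given the state `s'` in which the delay has just elapsed: sum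
over all edges `e` of `edgeProb s' e` times the law of `(tgt e, v'')`, where `v''` is drawn from
`resetDist e s'.2`. -/
def switchMeasure (s' : L × (Fin n → ℝ)) : Measure (L × (Fin n → ℝ)) :=
  ∑ e, H.edgeProb s' e • (H.resetDist e s'.2).map (Prod.mk (H.tgt e))

theorem switchMeasure_apply (s' : L × (Fin n → ℝ)) {B : Set (L × (Fin n → ℝ))}
    (hB : MeasurableSet B) : H.switchMeasure s' B =
      ∑ e, H.edgeProb s' e * H.resetDist e s'.2 {v'' | (H.tgt e, v'') ∈ B} := by
  simp only [switchMeasure, Measure.coe_finsetSum, Measure.coe_smul, Finset.sum_apply,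
    Pi.smul_apply, smul_eq_mul]
  refine Finset.sum_congr rfl fun e _ => ?_
  rw [Measure.map_apply measurable_prodMk_left hB]
  rfl

theorem measurable_switchMeasure : Measurable H.switchMeasure := by
  refine Measure.measurable_of_measurable_coe _ fun B hB => ?_
  simp only [H.switchMeasure_apply _ hB]
  refine Finset.measurable_sum _ fun e _ => (H.measurable_edgeProb e).mul ?_
  exact ((H.resetDist e).measurable_coe (measurable_prodMk_left hB)).comp measurable_snd

/-- The kernel of the stochastic transition system induced by `H`: draw a delay `τ`, then move
from `s + τ` according to `switchMeasure`. -/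
def step : Kernel (L × (Fin n → ℝ)) (L × (Fin n → ℝ)) where
  toFun s := (H.delayDist s).bind fun τ => H.switchMeasure (H.after s τ)
  measurable' := by
    refine Measure.measurable_of_measurable_coe _ fun B hB => ?_
    have h : Measurable fun p : (L × (Fin n → ℝ)) × ℝ≥0 => H.switchMeasure (H.after p.1 p.2) B :=
      (Measure.measurable_coe hB).comp (H.measurable_switchMeasure.comp H.measurable_after)
    have h' : ∀ s, Measurable fun τ => H.switchMeasure (H.after s τ) := fun s =>
      H.measurable_switchMeasure.comp (H.measurable_after.comp measurable_prodMk_left)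
    simp only [Measure.bind_apply hB (h' _).aemeasurable]
    exact h.lintegral_kernel_prod_right

theorem step_apply (s : L × (Fin n → ℝ)) {B : Set (L × (Fin n → ℝ))} (hB : MeasurableSet B) :
    H.step s B = ∫⁻ τ, ∑ e, H.edgeProb (H.after s τ) e *
      H.resetDist e (H.flow s.1 s.2 τ) {v'' | (H.tgt e, v'') ∈ B} ∂H.delayDist s := by
  have h' : Measurable fun τ => H.switchMeasure (H.after s τ) :=
    H.measurable_switchMeasure.comp (H.measurable_after.comp measurable_prodMk_left)
  change (H.delayDist s).bind (fun τ => H.switchMeasure (H.after s τ)) B = _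
  rw [Measure.bind_apply hB h'.aemeasurable]
  simp only [H.switchMeasure_apply _ hB]
  rfl

instance : IsMarkovKernel H.step := by
  refine ⟨fun s => ⟨?_⟩⟩
  rw [H.step_apply s MeasurableSet.univ]
  have h : ∀ᵐ τ ∂H.delayDist s, ∑ e, H.edgeProb (H.after s τ) e *
      H.resetDist e (H.flow s.1 s.2 τ) {v'' | (H.tgt e, v'') ∈ Set.univ} = 1 := by
    filter_upwards [H.delayDist_allowed s] with τ hτ
    obtain ⟨e, s', s'', hd, hs⟩ := hτ
    have := H.sum_edgeProb (H.after s τ) ⟨e, s', hd.2 ▸ hs⟩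
    simpa using this
  rw [lintegral_congr_ae h]
  simp

/-- The delay distribution at every state is absolutely continuous with respect to the Lebesgue
measure. -/
def PurelyContinuous : Prop :=
  ∀ s, (H.delayDist s).map ((↑) : ℝ≥0 → ℝ) ≪ volume

/-- Every guard compares a linear combination of the variables with a constant. (The comparisons
`>` and `≥` are obtained by changing signs.) -/
def LinearGuards : Prop :=
  ∀ e, ∃ (a : Fin n → ℤ) (c : ℤ),
    H.guard e = {v | ∑ i, (a i : ℝ) * v i < c} ∨ H.guard e = {v | ∑ i, (a i : ℝ) * v i ≤ c}

/-- In every location, each variable evolves with a constant positive integer slope. -/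
def PositiveIntegerSlopes : Prop :=
  ∀ l, ∃ k : Fin n → ℕ, (∀ i, 0 < k i) ∧
    ∀ v τ, H.flow l v τ = fun i => v i + (τ : ℝ) * (k i : ℝ)

end StochHybridSystem

/-! ## Finite descriptions of stochastic hybrid systems -/

/-- A location: the slope of each variable and a delay interval. -/
structure LocationCode where
  slopes : List ℤ
  delayLo : ℕ
  delayHi : ℕ

/-- An edge: its source and target, its guard `∑ i, coeffs i * x i < bound` (or `≤ bound` if it is
not strict), and the list of the variables that it resets to `0`. -/
structure EdgeCode where
  src : ℕ
  tgt : ℕ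
  coeffs : List ℤ
  strict : Bool
  bound : ℤ
  resets : List ℕ

/-- A description of a system with locations `0, …, otherLocs.length` (location `0` is `loc0`).
The entries missing from a list of coefficients or slopes are `0`, and location numbers are read
modulo the number of locations, so that every code describes something. -/
structure SHSCode where
  numVars : ℕ
  loc0 : LocationCode
  otherLocs : List LocationCode
  edges : List EdgeCode

/-- A description of an input of the reachability problems: a system, an initial state with
integer values, and a target location. -/
structure ReachCode where
  system : SHSCode
  initLoc : ℕ
  initVal : List ℤ
  target : ℕ

instance : Primcodable LocationCode :=
  Primcodable.ofEquiv (List ℤ × ℕ × ℕ)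
    { toFun := fun c => (c.slopes, c.delayLo, c.delayHi)
      invFun := fun p => ⟨p.1, p.2.1, p.2.2⟩
      left_inv := fun _ => rfl
      right_inv := fun _ => rfl }

instance : Primcodable EdgeCode :=
  Primcodable.ofEquiv (ℕ × ℕ × List ℤ × Bool × ℤ × List ℕ)
    { toFun := fun c => (c.src, c.tgt, c.coeffs, c.strict, c.bound, c.resets)
      invFun := fun p => ⟨p.1, p.2.1, p.2.2.1, p.2.2.2.1, p.2.2.2.2.1, p.2.2.2.2.2⟩
      left_inv := fun _ => rfl
      right_inv := fun _ => rfl }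

instance : Primcodable SHSCode :=
  Primcodable.ofEquiv (ℕ × LocationCode × List LocationCode × List EdgeCode)
    { toFun := fun c => (c.numVars, c.loc0, c.otherLocs, c.edges)
      invFun := fun p => ⟨p.1, p.2.1, p.2.2.1, p.2.2.2⟩
      left_inv := fun _ => rfl
      right_inv := fun _ => rfl }

instance : Primcodable ReachCode :=
  Primcodable.ofEquiv (SHSCode × ℕ × List ℤ × ℕ)
    { toFun := fun c => (c.system, c.initLoc, c.initVal, c.target)
      invFun := fun p => ⟨p.1, p.2.1, p.2.2.1, p.2.2.2⟩
      left_inv := fun _ => rfl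
      right_inv := fun _ => rfl }

namespace LocationCode

/-- The uniform distribution on `[delayLo, delayHi]` if `delayLo < delayHi`, and the Dirac
distribution at `delayLo` otherwise. -/
def delayDist (c : LocationCode) : Measure ℝ≥0 :=
  if c.delayLo < c.delayHi then
    (ProbabilityTheory.cond volume (Set.Icc (c.delayLo : ℝ) (c.delayHi : ℝ))).map Real.toNNReal
  else Measure.dirac (c.delayLo : ℝ≥0)

instance (c : LocationCode) : IsProbabilityMeasure c.delayDist := by
  unfold delayDist
  split_ifs with h
  · have : IsProbabilityMeasure
        (ProbabilityTheory.cond volume (Set.Icc (c.delayLo : ℝ) (c.delayHi : ℝ))) :=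
      cond_isProbabilityMeasure_of_finite (by simpa using h) (by simp)
    exact Measure.isProbabilityMeasure_map measurable_real_toNNReal.aemeasurable
  · infer_instance

end LocationCode

namespace EdgeCode

/-- The guard of an edge, in `n` variables. -/
def guardSet (c : EdgeCode) (n : ℕ) : Set (Fin n → ℝ) :=
  if c.strict then {v | ∑ i : Fin n, (c.coeffs.getD i 0 : ℝ) * v i < c.bound}
  else {v | ∑ i : Fin n, (c.coeffs.getD i 0 : ℝ) * v i ≤ c.bound}

/-- The reset of an edge, in `n` variables. -/
def resetMap (c : EdgeCode) (n : ℕ) (v : Fin n → ℝ) : Fin n → ℝ :=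
  fun i => if (i : ℕ) ∈ c.resets then 0 else v i

theorem measurableSet_guardSet (c : EdgeCode) (n : ℕ) : MeasurableSet (c.guardSet n) := by
  have h : Measurable fun v : Fin n → ℝ => ∑ i : Fin n, (c.coeffs.getD i 0 : ℝ) * v i := by
    fun_prop
  unfold guardSet
  split_ifs
  · exact measurableSet_lt h measurable_const
  · exact measurableSet_le h measurable_const

theorem measurable_resetMap (c : EdgeCode) (n : ℕ) : Measurable (c.resetMap n) := by
  refine measurable_pi_lambda _ fun i => ?_
  unfold resetMap
  split_ifs <;> fun_prop

end EdgeCode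

namespace SHSCode

variable (c : SHSCode)

/-- The locations. -/
abbrev Loc : Type := Fin (c.otherLocs.length + 1)

/-- The edges. -/
abbrev Edge : Type := Fin c.edges.length

/-- The states. -/
abbrev State : Type := c.Loc × (Fin c.numVars → ℝ)

/-- The location with a given number. -/
def toLoc (k : ℕ) : c.Loc := Fin.ofNat _ k

/-- The description of a location. -/
def locCode (l : c.Loc) : LocationCode := (c.loc0 :: c.otherLocs).get l

/-- The hybrid system that is described: constant slopes, trivial invariants, linear guards, and
deterministic resets of some variables to `0`. -/
def hybridSystem : HybridSystem c.Loc c.Edge c.numVars where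
  src e := c.toLoc (c.edges.get e).src
  tgt e := c.toLoc (c.edges.get e).tgt
  flow l v τ := fun i => v i + (τ : ℝ) * ((c.locCode l).slopes.getD i 0 : ℝ)
  continuous_flow l := by fun_prop
  inv _ := Set.univ
  guard e := (c.edges.get e).guardSet c.numVars
  reset e v := {(c.edges.get e).resetMap c.numVars v}

/-- The delay distribution depends on the location only. -/
def delayKernel : Kernel c.State ℝ≥0 :=
  (Kernel.ofFunOfCountable fun l : c.Loc => (c.locCode l).delayDist).comap Prod.fst
    measurable_fst

theorem delayKernel_apply (s : c.State) : c.delayKernel s = (c.locCode s.1).delayDist := rfl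

instance : IsMarkovKernel c.delayKernel :=
  ⟨fun s => by rw [delayKernel_apply]; infer_instance⟩

theorem enabled_iff (s : c.State) (e : c.Edge) : c.hybridSystem.Enabled s e ↔
    s.1 = c.hybridSystem.src e ∧ s.2 ∈ c.hybridSystem.guard e := by
  constructor
  · rintro ⟨s', h⟩
    exact ⟨h.1, h.2.2.1.2⟩
  · rintro ⟨h1, h2⟩
    exact ⟨(c.hybridSystem.tgt e, (c.edges.get e).resetMap c.numVars s.2), h1, rfl,
      ⟨Set.mem_univ _, h2⟩, Set.mem_singleton _, Set.mem_univ _⟩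

theorem measurableSet_enabled (e : c.Edge) :
    MeasurableSet {s : c.State | c.hybridSystem.Enabled s e} := by
  simp only [enabled_iff]
  exact (measurable_fst (measurableSet_singleton (c.hybridSystem.src e))).inter
    (measurable_snd ((c.edges.get e).measurableSet_guardSet c.numVars))

open Classical in
/-- The edge is chosen uniformly among the enabled ones. -/
def edgeProb (s : c.State) (e : c.Edge) : ℝ≥0∞ :=
  if c.hybridSystem.Enabled s e then
    (∑ e', if c.hybridSystem.Enabled s e' then (1 : ℝ≥0∞) else 0)⁻¹
  else 0

theorem measurable_edgeProb (e : c.Edge) : Measurable fun s => c.edgeProb s e := by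
  classical
  unfold edgeProb
  refine Measurable.ite (c.measurableSet_enabled e) (Measurable.inv ?_) measurable_const
  exact Finset.measurable_sum _ fun e' _ =>
    Measurable.ite (c.measurableSet_enabled e') measurable_const measurable_const

theorem edgeProb_pos_iff (s : c.State) (e : c.Edge) :
    0 < c.edgeProb s e ↔ c.hybridSystem.Enabled s e := by
  classical
  unfold edgeProb
  split_ifs with h
  · simp [h]
  · simp [h]

theorem sum_edgeProb (s : c.State) (h : ∃ e, c.hybridSystem.Enabled s e) :
    ∑ e, c.edgeProb s e = 1 := by
  classical
  obtain ⟨e, he⟩ := h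
  have h1 : ∀ e, c.edgeProb s e = (if c.hybridSystem.Enabled s e then (1 : ℝ≥0∞) else 0) *
      (∑ e', if c.hybridSystem.Enabled s e' then (1 : ℝ≥0∞) else 0)⁻¹ := by
    intro e
    unfold edgeProb
    split_ifs <;> simp
  simp only [h1]
  rw [← Finset.sum_mul]
  refine ENNReal.mul_inv_cancel ?_ ?_
  · rw [Ne, Finset.sum_eq_zero_iff]
    intro h0
    simpa [he] using h0 e (Finset.mem_univ e)
  · simp

/-- From every state, almost surely, an edge is enabled after the delay. -/
def NonBlocking : Prop :=
  ∀ s : c.State, ∀ᵐ τ ∂c.delayKernel s, τ ∈ c.hybridSystem.allowedDelays s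

/-- The stochastic hybrid system that is described. -/
def toSHS (h : c.NonBlocking) : StochHybridSystem c.Loc c.Edge c.numVars where
  toHybridSystem := c.hybridSystem
  measurableSet_inv _ := MeasurableSet.univ
  measurableSet_guard e := (c.edges.get e).measurableSet_guardSet c.numVars
  measurableSet_reset _ _ := measurableSet_singleton _
  delayDist := c.delayKernel
  isMarkov_delayDist := inferInstance
  delayDist_allowed := h
  resetDist e := Kernel.deterministic _ ((c.edges.get e).measurable_resetMap c.numVars)
  isMarkov_resetDist _ := inferInstance
  resetDist_reset e v := by
    rw [Kernel.deterministic_apply]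
    exact (ae_dirac_iff (measurableSet_singleton _)).2 rfl
  edgeProb := c.edgeProb
  measurable_edgeProb := c.measurable_edgeProb
  edgeProb_pos_iff := c.edgeProb_pos_iff
  sum_edgeProb := c.sum_edgeProb

end SHSCode

/-! ## The reachability problems -/

/-- An input of the reachability problems: the description of a stochastic hybrid system with
purely continuous delay distributions, linear guards and positive integer slopes, together with
an initial state and a target location. -/
structure ReachInstance where
  code : ReachCode
  nonBlocking : code.system.NonBlocking
  purelyContinuous : (code.system.toSHS nonBlocking).PurelyContinuous
  linearGuards : (code.system.toSHS nonBlocking).LinearGuards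
  positiveIntegerSlopes : (code.system.toSHS nonBlocking).PositiveIntegerSlopes

namespace ReachInstance

variable (I : ReachInstance)

/-- The initial state. -/
def init : I.code.system.State :=
  (I.code.system.toLoc I.code.initLoc, fun i => (I.code.initVal.getD i 0 : ℝ))

/-- The set of target states: all states in the target location. -/
def target : Set I.code.system.State := {s | s.1 = I.code.system.toLoc I.code.target}

/-- The probability of eventually reaching the target set. -/
def prob : ℝ :=
  reachProb (I.code.system.toSHS I.nonBlocking).step (Measure.dirac I.init) I.target

end ReachInstance

/-- The rational number `a / (b + 1)` given by a pair `(a, b)`. -/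
def ratOfPair (x : ℤ × ℕ) : ℚ := (x.1 : ℚ) / ((x.2 : ℚ) + 1)

/-- The decision problem `P` on inputs of type `ι`, where the input `x` is presented to the
algorithm as `enc x`, is decidable: some algorithm halts with the right answer on each input
(nothing is asked of it on data that present no input). -/
def DecidableProblem {ι α : Type} [Primcodable α] (enc : ι → α) (P : ι → Prop) : Prop :=
  ∃ f : α →. Bool, Partrec f ∧ ∀ x, ∃ b ∈ f (enc x), (b = true ↔ P x)

/-- Some algorithm computes, for each input, a rational number at distance at most `ε` of
the reachability probability. -/
def ApproximableWithin (ε : ℝ) : Prop :=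
  ∃ f : ReachCode →. ℤ × ℕ, Partrec f ∧
    ∀ I : ReachInstance, ∃ q ∈ f I.code, |I.prob - (ratOfPair q : ℝ)| ≤ ε

end

/-! The halting problem of register machines is reduced to reachability with a zero-one gap: the
target location of the constructed system is reached with probability `1` if the machine halts and
with probability `0` if it does not (`reachProb_machineKernel`). An answer to any of the problems,
with precision below `1/2` where one is involved, tells these two values apart.

All slopes are positive, so the content of a register is stored as a difference of two variables,
which is constant while both have slope `1` and grows while the first has slope `2`. As delays are
random, incrementations are inexact; the difference of the variables `2` and `3` is a budget that
dominates the error of every register. In the first phase of an incrementation a delay `τ` raises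
the budget by `τ`, and the guard keeps the budget at most `1/8`. In the second phase a delay `τ' ≥
1` is added to the register, and the guard enforces `τ' ≤ 1 + τ`; the new error is thus covered by
what was just paid (`IsMain.inc`, `IsMid.inc`). Two integers are compared with thresholds at
distance one half from `0`; errors of `1/8` in each never lead to the wrong branch (`IsMain.jlt`).
Setting a register to zero is exact.

In every location a restart edge with a true guard clears all variables except those of register
`0`, which holds the input exactly because the machine never writes to it. Hence no state blocks,
and a run that has used up its budget can start over. If the machine halts, every state of the
invariant set `runStates` restarts and then completes an accurate simulation with probability
bounded below, within a bounded number of steps (`exists_le_hitWithin`); repeated trials give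
probability `1` (`reachProb_eq_one_of_hitWithin`). If it does not halt, `runStates` is still
invariant (`machineKernel_compl_runStates`) and misses the target.

A suitable machine comes from `exists_machine_undecidable`: primitive recursive functions are
computed by structured programs, these are compiled, and an unbounded search for a zero expresses
the halting problem for partial recursive codes. -/

noncomputable section

/-! ## Reachability in stochastic transition systems -/

section Reachability

variable {S : Type*} [MeasurableSpace S] (κ : Kernel S S)

/-- The probability of visiting `G` within the first `m` steps. -/
def hitWithin (G : Set S) : ℕ → S → ℝ≥0∞
  | 0, s => G.indicator 1 s
  | m + 1, s => G.indicator 1 s + Gᶜ.indicator (fun s => ∫⁻ s', hitWithin G m s' ∂κ s) s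

theorem measurable_hitWithin {G : Set S} (hG : MeasurableSet G) (m : ℕ) :
    Measurable (hitWithin κ G m) := by
  induction m with
  | zero => exact measurable_one.indicator hG
  | succ m ih =>
    exact (measurable_one.indicator hG).add (ih.lintegral_kernel.indicator hG.compl)

theorem hitWithin_eq_one {G : Set S} {s : S} (hs : s ∈ G) (m : ℕ) : hitWithin κ G m s = 1 := by
  cases m <;> simp [hitWithin, hs]

/-- The runs that do not visit `G` before time `k`. -/
def avoidBefore (G : Set S) (k : ℕ) : Set (ℕ → S) := {ω | ∀ j < k, ω j ∉ G}

theorem measurableSet_avoidBefore {G : Set S} (hG : MeasurableSet G) (k : ℕ) :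
    MeasurableSet (avoidBefore G k) := by
  have : avoidBefore G k = ⋂ j, ⋂ (_ : j < k), (fun ω : ℕ → S => ω j) ⁻¹' Gᶜ := by
    ext; simp [avoidBefore]
  rw [this]
  exact .iInter fun j => .iInter fun _ => measurable_pi_apply j hG.compl

theorem avoidBefore_succ {S : Type*} (G : Set S) (k : ℕ) :
    avoidBefore G (k + 1) = avoidBefore G k \ {ω | ω k ∈ G} := by
  ext ω
  simp only [avoidBefore, Set.mem_ofPred_eq, Set.mem_sdiff, Nat.lt_succ_iff_lt_or_eq]
  constructor
  · exact fun h => ⟨fun j hj => h j (.inl hj), h k (.inr rfl)⟩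
  · rintro ⟨h1, h2⟩ j (hj | rfl)
    exacts [h1 j hj, h2]

/-! ### The Markov property of the run measure and repeated trials -/

variable [IsMarkovKernel κ]

theorem runMeasure_eq_trajMeasure (μ : Measure S) :
    runMeasure κ μ = Kernel.trajMeasure (X := fun _ => S) μ (historyKernel κ) := rfl

instance (μ : Measure S) [IsProbabilityMeasure μ] : IsProbabilityMeasure (runMeasure κ μ) := by
  rw [runMeasure_eq_trajMeasure]; infer_instance

theorem runMeasure_map_zero (μ : Measure S) [IsProbabilityMeasure μ] :
    (runMeasure κ μ).map (fun ω => ω 0) = μ := by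
  have h : (runMeasure κ μ).map (Preorder.frestrictLe (π := fun _ => S) 0) =
      μ.map (fun s (_ : Finset.Iic 0) => s) := by
    have : runMeasure κ μ = Kernel.traj (X := fun _ => S) (historyKernel κ) 0 ∘ₘ
      (μ.map (fun s (_ : Finset.Iic 0) => s)) := rfl
    rw [this, Measure.map_comp _ _ (by fun_prop), Kernel.traj_map_frestrictLe,
      Kernel.partialTraj_self, Measure.id_comp]
  have h0 : (fun ω : ℕ → S => ω 0) =
      (fun x : (Π _ : Finset.Iic 0, S) => x ⟨0, Finset.mem_Iic.2 le_rfl⟩) ∘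
        Preorder.frestrictLe (π := fun _ => S) 0 := rfl
  rw [h0, ← Measure.map_map (by fun_prop) (by fun_prop), h,
    Measure.map_map (by fun_prop) (by fun_prop)]
  exact Measure.map_id

/-- This is the Markov property in integrated form: the joint law of the history up to `k` and the
next state is a composition product with `historyKernel`, which looks at the last state only. -/
theorem lintegral_history_mul_next (μ : Measure S) [IsProbabilityMeasure μ] (k : ℕ)
    {g : (Π _ : Finset.Iic k, S) → ℝ≥0∞} (hg : Measurable g) {f : S → ℝ≥0∞} (hf : Measurable f) :
    ∫⁻ ω, g (Preorder.frestrictLe k ω) * f (ω (k + 1)) ∂runMeasure κ μ =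
      ∫⁻ ω, g (Preorder.frestrictLe k ω) * ∫⁻ s, f s ∂κ (ω k) ∂runMeasure κ μ := by
  have h := Kernel.map_frestrictLe_trajMeasure_compProd_eq_map_trajMeasure (X := fun _ => S)
    (μ₀ := μ) (κ := historyKernel κ) (a := k)
  rw [← runMeasure_eq_trajMeasure] at h
  have hm : Measurable fun p : (Π _ : Finset.Iic k, S) × S => g p.1 * f p.2 := by fun_prop
  calc _ = ∫⁻ p, g p.1 * f p.2 ∂((runMeasure κ μ).map
          (fun x ↦ (Preorder.frestrictLe (π := fun _ => S) k x, x (k + 1)))) := by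
        rw [lintegral_map hm (by fun_prop)]
    _ = _ := by
        rw [← h, Measure.lintegral_compProd hm, lintegral_map _ (by fun_prop)]
        · refine lintegral_congr fun ω => ?_
          exact lintegral_const_mul (g (Preorder.frestrictLe k ω)) hf
        · exact hm.lintegral_kernel_prod_right'

theorem ae_run_mem (μ : Measure S) [IsProbabilityMeasure μ] {I : Set S} (hI : MeasurableSet I)
    (h0 : ∀ᵐ s ∂μ, s ∈ I) (hstep : ∀ s ∈ I, κ s Iᶜ = 0) (k : ℕ) :
    ∀ᵐ ω ∂runMeasure κ μ, ω k ∈ I := by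
  induction k with
  | zero =>
    rw [← runMeasure_map_zero κ μ] at h0
    exact ae_of_ae_map (measurable_pi_apply 0).aemeasurable h0
  | succ k ih =>
    have h := lintegral_history_mul_next κ μ k (g := fun _ => 1) measurable_const
      (f := Iᶜ.indicator 1) (measurable_one.indicator hI.compl)
    have h1 : ∫⁻ ω, 1 * ∫⁻ s, Iᶜ.indicator 1 s ∂κ (ω k) ∂runMeasure κ μ = 0 := by
      rw [lintegral_congr_ae (g := fun _ => 0)]
      · simp
      · filter_upwards [ih] with ω hω
        rw [lintegral_indicator_one hI.compl, hstep _ hω, mul_zero]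
    rw [h1] at h
    rw [lintegral_eq_zero_iff (by
      have := (measurable_one (α := ℝ≥0∞)).indicator hI.compl
      fun_prop)] at h
    filter_upwards [h] with ω hω
    by_contra hc
    simp [Set.indicator, hc] at hω

/-- Moving into `R` first and hitting `G` from there is one way to succeed. Outside `G` this bounds
the integral over the next state; inside `G` the value is `1`, for which `a ≤ 1` is needed. -/
theorem mul_le_hitWithin_succ {G R : Set S} (hR : MeasurableSet R) {m : ℕ} {a b : ℝ≥0∞}
    (ha : ∀ s ∈ R, a ≤ hitWithin κ G m s) (ha1 : a ≤ 1) {s : S} (hb : b ≤ κ s R) :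
    b * a ≤ hitWithin κ G (m + 1) s := by
  by_cases hs : s ∈ G
  · rw [hitWithin_eq_one κ hs]
    exact mul_le_one' (hb.trans prob_le_one) ha1
  · simp only [hitWithin, Set.indicator_of_notMem hs, zero_add,
      Set.indicator_of_mem (Set.mem_compl hs)]
    calc b * a ≤ a * κ s R := by rw [mul_comm]; gcongr
      _ = ∫⁻ s', R.indicator (fun _ => a) s' ∂κ s := by rw [lintegral_indicator_const hR]
      _ ≤ _ := lintegral_mono fun s' => Set.indicator_le (fun s hs => ha s hs) s'

theorem setLIntegral_avoidBefore_next (μ : Measure S) [IsProbabilityMeasure μ] {G : Set S}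
    (hG : MeasurableSet G) (k : ℕ) {f : S → ℝ≥0∞} (hf : Measurable f) :
    ∫⁻ ω in avoidBefore G (k + 1), f (ω (k + 1)) ∂runMeasure κ μ =
      ∫⁻ ω in avoidBefore G (k + 1), ∫⁻ s, f s ∂κ (ω k) ∂runMeasure κ μ := by
  -- Avoiding `G` at the times `0, …, k` is an event of the history up to `k`, so its indicator can
  -- play the role of `g` in the Markov property.
  let A : Set (Π _ : Finset.Iic k, S) := ⋂ j, (fun x => x j) ⁻¹' Gᶜ
  have hA : MeasurableSet A := .iInter fun j => measurable_pi_apply j hG.compl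
  have hmem : ∀ ω : ℕ → S, ω ∈ avoidBefore G (k + 1) ↔
      Preorder.frestrictLe (π := fun _ => S) k ω ∈ A := by
    intro ω
    simp only [avoidBefore, A, Set.mem_ofPred_eq, Set.mem_iInter, Set.mem_preimage, Set.mem_compl_iff,
      Preorder.frestrictLe_apply]
    constructor
    · intro h j
      exact h j (Nat.lt_succ_of_le (Finset.mem_Iic.1 j.2))
    · intro h j hj
      exact h ⟨j, Finset.mem_Iic.2 (Nat.le_of_lt_succ hj)⟩
  have h := lintegral_history_mul_next κ μ k (g := A.indicator 1) (measurable_one.indicator hA) hf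
  rw [← lintegral_indicator (measurableSet_avoidBefore hG _),
    ← lintegral_indicator (measurableSet_avoidBefore hG _)]
  convert h using 3 with ω ω <;> by_cases hω : ω ∈ avoidBefore G (k + 1) <;>
    simp [Set.indicator, hω, ← hmem]

/-- A run avoiding `G` before time `k` either visits it at one of the times `k, …, k + m` or avoids
it before `k + m + 1`; by the Markov property the integral is the probability of the first case. -/
theorem setLIntegral_hitWithin_add (μ : Measure S) [IsProbabilityMeasure μ] {G : Set S}
    (hG : MeasurableSet G) (m k : ℕ) :
    ∫⁻ ω in avoidBefore G k, hitWithin κ G m (ω k) ∂runMeasure κ μ +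
      runMeasure κ μ (avoidBefore G (k + m + 1)) = runMeasure κ μ (avoidBefore G k) := by
  have hGk : ∀ k, MeasurableSet {ω : ℕ → S | ω k ∈ G} := fun k => measurable_pi_apply k hG
  have hsplit : ∀ k, runMeasure κ μ ({ω | ω k ∈ G} ∩ avoidBefore G k) +
      runMeasure κ μ (avoidBefore G (k + 1)) = runMeasure κ μ (avoidBefore G k) := by
    intro k
    rw [avoidBefore_succ, Set.inter_comm]
    exact measure_inter_add_sdiff _ (hGk k)
  have hind : ∀ k, ∫⁻ ω in avoidBefore G k, G.indicator 1 (ω k) ∂runMeasure κ μ =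
      runMeasure κ μ ({ω | ω k ∈ G} ∩ avoidBefore G k) := by
    intro k
    rw [← Measure.restrict_apply (hGk k), ← lintegral_indicator_one (hGk k)]
    rfl
  induction m generalizing k with
  | zero => simp only [hitWithin, add_zero, hind, hsplit]
  | succ m ih =>
    have hc : ∫⁻ ω in avoidBefore G k, Gᶜ.indicator
        (fun s => ∫⁻ s', hitWithin κ G m s' ∂κ s) (ω k) ∂runMeasure κ μ =
        ∫⁻ ω in avoidBefore G (k + 1), hitWithin κ G m (ω (k + 1)) ∂runMeasure κ μ := by
      rw [setLIntegral_avoidBefore_next κ μ hG k (measurable_hitWithin κ hG m), avoidBefore_succ,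
        Set.sdiff_eq, Set.inter_comm, ← Measure.restrict_restrict (hGk k).compl,
        ← lintegral_indicator (hGk k).compl]
      rfl
    have hm : Measurable fun ω : ℕ → S => G.indicator (1 : S → ℝ≥0∞) (ω k) :=
      (measurable_one.indicator hG).comp (measurable_pi_apply k)
    simp only [hitWithin]
    rw [lintegral_add_left hm, hind, hc, add_assoc, show k + (m + 1) + 1 = k + 1 + m + 1 by omega,
      ih, hsplit]

/-- If every state of an invariant set reaches `G` within `m` steps with probability at least `c`,
then `G` is reached almost surely. -/
theorem reachProb_eq_one_of_hitWithin (μ : Measure S) [IsProbabilityMeasure μ] {G I : Set S}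
    (hG : MeasurableSet G) (hI : MeasurableSet I) (h0 : ∀ᵐ s ∂μ, s ∈ I)
    (hstep : ∀ s ∈ I, κ s Iᶜ = 0) {m : ℕ} {c : ℝ≥0∞} (hc : c ≠ 0)
    (hhit : ∀ s ∈ I, c ≤ hitWithin κ G m s) : reachProb κ μ G = 1 := by
  set a := runMeasure κ μ (⋂ k, avoidBefore G k) with ha
  -- Each block of `m + 1` times removes at least `c * a` from the probability of having avoided
  -- `G`, where `a` is the probability of avoiding it forever.
  have hle : ∀ k, c * a + runMeasure κ μ (avoidBefore G (k + m + 1)) ≤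
      runMeasure κ μ (avoidBefore G k) := by
    intro k
    rw [← setLIntegral_hitWithin_add κ μ hG m k]
    gcongr
    calc c * a ≤ c * runMeasure κ μ (avoidBefore G k) := by
          gcongr; exact measure_mono (Set.iInter_subset _ _)
      _ = ∫⁻ ω in avoidBefore G k, c ∂runMeasure κ μ := by simp
      _ ≤ _ := lintegral_mono_ae (ae_restrict_of_ae ((ae_run_mem κ μ hI h0 hstep k).mono
          fun ω hω => hhit _ hω))
  have hanti : Antitone fun k => avoidBefore (S := S) G k :=
    fun i j hij ω hω k hk => hω k (hk.trans_le hij)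
  have hlim := tendsto_measure_iInter_atTop (μ := runMeasure κ μ)
    (fun k => (measurableSet_avoidBefore hG k).nullMeasurableSet) hanti ⟨0, measure_ne_top _ _⟩
  have hlim' : Filter.Tendsto (fun k => runMeasure κ μ (avoidBefore G (k + m + 1))) Filter.atTop
      (nhds a) := by
    simpa only [add_assoc, Function.comp_def] using
      hlim.comp (Filter.tendsto_add_atTop_nat (m + 1))
  -- Both avoidance probabilities tend to `a`; since `a` is finite and `c ≠ 0`, the limit inequality
  -- forces `a = 0`.
  have hfin : c * a + a ≤ a :=
    le_of_tendsto_of_tendsto' (tendsto_const_nhds.add hlim') hlim hle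
  have ha0 : a = 0 := by
    have : c * a + a ≤ 0 + a := by simpa using hfin
    have := (ENNReal.add_le_add_iff_right (measure_ne_top _ _)).1 this
    simpa [hc] using this
  have hev : eventually G = (⋂ k, avoidBefore G k)ᶜ := by
    ext ω
    simp only [eventually, avoidBefore, Set.mem_ofPred_eq, Set.mem_compl_iff, Set.mem_iInter,
      not_forall, not_not]
    exact ⟨fun ⟨k, hk⟩ => ⟨k + 1, k, k.lt_succ_self, hk⟩, fun ⟨_, j, _, hj⟩ => ⟨j, hj⟩⟩
  rw [reachProb, hev, probReal_compl_eq_one_sub (.iInter fun k => measurableSet_avoidBefore hG k),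
    Measure.real, ← ha, ha0]
  simp

theorem reachProb_eq_zero_of_disjoint (μ : Measure S) [IsProbabilityMeasure μ] {G I : Set S}
    (hI : MeasurableSet I) (h0 : ∀ᵐ s ∂μ, s ∈ I) (hstep : ∀ s ∈ I, κ s Iᶜ = 0)
    (hdisj : Disjoint I G) : reachProb κ μ G = 0 := by
  rw [reachProb, measureReal_eq_zero_iff, measure_eq_zero_iff_ae_notMem]
  filter_upwards [ae_all_iff.2 (ae_run_mem κ μ hI h0 hstep)] with ω hω ⟨k, hk⟩
  exact hdisj.notMem_of_mem_left (hω k) hk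

end Reachability

/-! ## Register machines -/

/-- An instruction of a register machine. Each instruction contains the addresses of its
successors; `jlt r s a b` jumps to `a` if the content of `r` is less than that of `s`, and to `b`
otherwise. -/
inductive Instr where
  | inc (r a : ℕ)
  | zero (r a : ℕ)
  | jlt (r s a b : ℕ)

/-- One step of a register machine, which halts when its address is that of no instruction. -/
def machineStep (M : List Instr) (c : ℕ × (ℕ → ℕ)) : ℕ × (ℕ → ℕ) :=
  match M[c.1]? with
  | none => c
  | some (.inc r a) => (a, Function.update c.2 r (c.2 r + 1))
  | some (.zero r a) => (a, Function.update c.2 r 0)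
  | some (.jlt r s a b) => (if c.2 r < c.2 s then a else b, c.2)

/-- The machine `M`, started at address `0` with the given registers, halts. -/
def MachineHalts (M : List Instr) (σ : ℕ → ℕ) : Prop :=
  ∃ j, M.length ≤ ((machineStep M)^[j] (0, σ)).1

theorem machineStep_of_length_le {M : List Instr} {c : ℕ × (ℕ → ℕ)} (h : M.length ≤ c.1) :
    machineStep M c = c := by
  simp [machineStep, List.getElem?_eq_none h]

theorem machineStep_iterate_of_length_le {M : List Instr} {c : ℕ × (ℕ → ℕ)} {i j : ℕ}
    (hij : i ≤ j) (h : M.length ≤ ((machineStep M)^[i] c).1) :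
    (machineStep M)^[j] c = (machineStep M)^[i] c := by
  induction j, hij using Nat.le_induction with
  | base => rfl
  | succ j _ ih => rw [Function.iterate_succ_apply', ih, machineStep_of_length_le h]

/-! ### Structured programs and primitive recursive functions -/

/-- Structured programs over registers. -/
inductive Prog where
  | inc (r : ℕ)
  | zero (r : ℕ)
  | seq (P Q : Prog)
  | whileLt (r s : ℕ) (P : Prog)

namespace Prog

/-- The program contains an instruction that changes the register. -/
def Writes : Prog → ℕ → Prop
  | inc r, w => w = r
  | zero r, w => w = r
  | seq P Q, w => P.Writes w ∨ Q.Writes w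
  | whileLt _ _ P, w => P.Writes w

/-- Termination of a program, with the contents of the registers before and after. -/
inductive Exec : Prog → (ℕ → ℕ) → (ℕ → ℕ) → Prop
  | inc (r σ) : Exec (inc r) σ (Function.update σ r (σ r + 1))
  | zero (r σ) : Exec (zero r) σ (Function.update σ r 0)
  | seq {P Q σ σ₁ σ₂} : Exec P σ σ₁ → Exec Q σ₁ σ₂ → Exec (seq P Q) σ σ₂
  | whileDone {r s P σ} : ¬ σ r < σ s → Exec (whileLt r s P) σ σ
  | whileStep {r s P σ σ₁ σ₂} : σ r < σ s → Exec P σ σ₁ → Exec (whileLt r s P) σ₁ σ₂ →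
      Exec (whileLt r s P) σ σ₂

theorem Exec.eq_of_not_writes {P : Prog} {σ σ' : ℕ → ℕ} (h : P.Exec σ σ') {w : ℕ}
    (hw : ¬ P.Writes w) : σ' w = σ w := by
  induction h with
  | inc r σ => exact Function.update_of_ne hw _ _
  | zero r σ => exact Function.update_of_ne hw _ _
  | seq _ _ ih1 ih2 =>
    rw [ih2 fun h => hw (.inr h), ih1 fun h => hw (.inl h)]
  | whileDone => rfl
  | whileStep _ _ _ ih1 ih2 => rw [ih2 hw, ih1 hw]

/-- A loop rule for total correctness: the invariant is indexed by the number of completed rounds,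
and knowing the final number `n` gives termination by downward induction. -/
theorem exists_exec_whileLt {r s : ℕ} {P : Prog} {n : ℕ} (inv : ℕ → (ℕ → ℕ) → Prop)
    (hstep : ∀ i < n, ∀ σ, inv i σ → σ r < σ s ∧ ∃ σ', P.Exec σ σ' ∧ inv (i + 1) σ')
    (hdone : ∀ σ, inv n σ → ¬ σ r < σ s) {i : ℕ} (hi : i ≤ n) {σ : ℕ → ℕ} (hσ : inv i σ) :
    ∃ σ', (whileLt r s P).Exec σ σ' ∧ inv n σ' := by
  induction hi using Nat.decreasingInduction generalizing σ with
  | self => exact ⟨σ, .whileDone (hdone σ hσ), hσ⟩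
  | of_succ i hi ih =>
    obtain ⟨hlt, σ₁, h1, h2⟩ := hstep i hi σ hσ
    obtain ⟨σ', h3, h4⟩ := ih h2
    exact ⟨σ', .whileStep hlt h1 h3, h4⟩

/-- The program that copies the content of `src` to `dst`. -/
def copy (src dst : ℕ) : Prog := seq (zero dst) (whileLt dst src (inc dst))

theorem writes_copy {src dst w : ℕ} : (copy src dst).Writes w ↔ w = dst := by
  simp [copy, Writes]

theorem exists_exec_copy {src dst : ℕ} (h : src ≠ dst) (σ : ℕ → ℕ) :
    ∃ σ', (copy src dst).Exec σ σ' ∧ σ' dst = σ src := by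
  obtain ⟨σ', h1, h2, -⟩ := exists_exec_whileLt (r := dst) (s := src) (P := inc dst)
    (n := σ src) (fun i τ => τ dst = i ∧ τ src = σ src)
    (fun i hi τ hτ => ⟨by omega, _, .inc _ _, by simp [hτ.1], by simp [h, hτ.2]⟩)
    (fun τ hτ => by omega) (i := 0) (Nat.zero_le _) (σ := Function.update σ dst 0)
    ⟨by simp, by simp [h]⟩
  exact ⟨σ', .seq (.zero _ _) h1, h2⟩

/-- The program computes `f` from the contents of the registers `ins` into the register `out`,
and apart from `out` it only changes registers from `fresh` on. -/
def Computes (P : Prog) {n : ℕ} (ins : Fin n → ℕ) (out fresh : ℕ)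
    (f : List.Vector ℕ n → ℕ) : Prop :=
  (∀ w, P.Writes w → w = out ∨ fresh ≤ w) ∧
    ∀ σ, ∃ σ', P.Exec σ σ' ∧ σ' out = f (List.Vector.ofFn fun i => σ (ins i))

/-- This serves composition. The results go to consecutive registers from `fresh` on, and the
temporaries of all components start at `fresh + n`, so no component destroys an earlier result or an
input. -/
theorem exists_computes_family {m n : ℕ} {g : Fin n → List.Vector ℕ m → ℕ}
    (hg : ∀ (i : Fin n) (ins : Fin m → ℕ) (out fresh : ℕ), (∀ j, ins j < fresh) → out < fresh →
      (∀ j, ins j ≠ out) → ∃ P : Prog, P.Computes ins out fresh (g i))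
    {ins : Fin m → ℕ} {fresh : ℕ} (hins : ∀ j, ins j < fresh) (k : ℕ) (hk : k ≤ n) :
    ∃ P : Prog, (∀ w, P.Writes w → fresh ≤ w) ∧ ∀ σ, ∃ σ', P.Exec σ σ' ∧
      ∀ i : Fin n, (i : ℕ) < k →
        σ' (fresh + i) = g i (List.Vector.ofFn fun j => σ (ins j)) := by
  induction k with
  | zero =>
    -- There is no empty program; zeroing a fresh register replaces it.
    exact ⟨zero fresh, fun w hw => (show w = fresh from hw).ge, fun σ => ⟨_, .zero _ _, by simp⟩⟩
  | succ k ih =>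
    obtain ⟨P, hP, hP'⟩ := ih (by omega)
    obtain ⟨Q, hQ, hQ'⟩ := hg ⟨k, hk⟩ ins (fresh + k) (fresh + n)
      (fun j => (hins j).trans_le (by omega)) (by omega) (fun j => by have := hins j; omega)
    refine ⟨seq P Q, ?_, fun σ => ?_⟩
    · rintro w (hw | hw)
      · exact hP w hw
      · rcases hQ w hw with h | h <;> omega
    · obtain ⟨σ₁, h1, h1'⟩ := hP' σ
      obtain ⟨σ₂, h2, h2'⟩ := hQ' σ₁
      refine ⟨σ₂, .seq h1 h2, fun i hi => ?_⟩
      have hsame : ∀ j, σ₁ (ins j) = σ (ins j) := fun j =>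
        h1.eq_of_not_writes fun h => absurd (hP _ h) (by have := hins j; omega)
      by_cases hik : (i : ℕ) = k
      · obtain rfl : i = ⟨k, hk⟩ := Fin.ext hik
        simpa only [hsame] using h2'
      · rw [h2.eq_of_not_writes, h1' i (by omega)]
        intro h
        have := i.isLt
        rcases hQ _ h with h | h <;> omega

/-- Primitive recursion becomes a counting loop: `fresh` is the counter, `fresh + 1` the value
accumulated so far, `fresh + 2` receives the value of `g`, and temporaries start at `fresh + 3`. The
register `out` is written only after the loop, which still reads the inputs. -/
theorem exists_computes_prec {n : ℕ} {f : List.Vector ℕ n → ℕ} {g : List.Vector ℕ (n + 2) → ℕ}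
    (hf : ∀ (ins : Fin n → ℕ) (out fresh : ℕ), (∀ j, ins j < fresh) → out < fresh →
      (∀ j, ins j ≠ out) → ∃ P : Prog, P.Computes ins out fresh f)
    (hg : ∀ (ins : Fin (n + 2) → ℕ) (out fresh : ℕ), (∀ j, ins j < fresh) → out < fresh →
      (∀ j, ins j ≠ out) → ∃ P : Prog, P.Computes ins out fresh g)
    (ins : Fin (n + 1) → ℕ) (out fresh : ℕ) (hins : ∀ j, ins j < fresh) (hout : out < fresh) :
    ∃ P : Prog, P.Computes ins out fresh fun v : List.Vector ℕ (n + 1) =>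
      v.head.rec (f v.tail) fun y IH => g (y ::ᵥ IH ::ᵥ v.tail) := by
  obtain ⟨F, hF, hF'⟩ := hf (fun j => ins j.succ) (fresh + 1) (fresh + 3)
    (fun j => (hins _).trans (by omega)) (by omega) (fun j => by have := hins j.succ; omega)
  obtain ⟨G, hG, hG'⟩ := hg (Fin.cons fresh (Fin.cons (fresh + 1) fun j => ins j.succ))
    (fresh + 2) (fresh + 3)
    (fun j => by
      refine Fin.cases ?_ (fun j => Fin.cases ?_ (fun j => ?_) j) j
      · simp
      · simp
      · simpa using (hins j.succ).trans (by omega))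
    (by omega)
    (fun j => by
      refine Fin.cases ?_ (fun j => Fin.cases ?_ (fun j => ?_) j) j
      · simp
      · simp
      · have := hins j.succ
        simp only [Fin.cons_succ]
        omega)
  refine ⟨seq F (seq (zero fresh) (seq (whileLt fresh (ins 0)
    (seq G (seq (copy (fresh + 2) (fresh + 1)) (inc fresh)))) (copy (fresh + 1) out))), ?_,
    fun σ => ?_⟩
  · intro w hw
    simp only [Writes, writes_copy] at hw
    rcases hw with hw | hw | (hw | hw | hw) | hw
    · rcases hF w hw with h | h <;> omega
    · omega
    · rcases hG w hw with h | h <;> omega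
    all_goals omega
  · obtain ⟨σ₁, h1, h1'⟩ := hF' σ
    have hσ₁ : ∀ j, σ₁ (ins j) = σ (ins j) := fun j => h1.eq_of_not_writes fun h => by
      have := hins j
      rcases hF _ h with h | h <;> omega
    let R : ℕ → ℕ := fun y => y.rec (f (List.Vector.ofFn fun j => σ (ins j.succ)))
      fun y IH => g (y ::ᵥ IH ::ᵥ List.Vector.ofFn fun j => σ (ins j.succ))
    obtain ⟨σ₂, h2, h2a, h2b, h2c⟩ := exists_exec_whileLt (r := fresh) (s := ins 0)
      (P := seq G (seq (copy (fresh + 2) (fresh + 1)) (inc fresh))) (n := σ (ins 0))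
      (fun i τ => τ fresh = i ∧ τ (fresh + 1) = R i ∧ ∀ j, τ (ins j) = σ (ins j))
      (fun i hi τ hτ => by
        obtain ⟨ha, hb, hc⟩ := hτ
        refine ⟨by rw [ha, hc]; exact hi, ?_⟩
        obtain ⟨τ₁, t1, t1'⟩ := hG' τ
        obtain ⟨τ₂, t2, t2'⟩ := exists_exec_copy (src := fresh + 2) (dst := fresh + 1)
          (by omega) τ₁
        refine ⟨_, .seq t1 (.seq t2 (.inc _ _)), ?_, ?_, fun j => ?_⟩
        · rw [Function.update_self, t2.eq_of_not_writes (by simp [writes_copy]),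
            t1.eq_of_not_writes fun h => by rcases hG _ h with h | h <;> omega, ha]
        · rw [Function.update_of_ne (by omega), t2', t1']
          have : (List.Vector.ofFn fun i =>
              τ ((Fin.cons fresh (Fin.cons (fresh + 1) fun j => ins j.succ) :
                Fin (n + 2) → ℕ) i)) =
              i ::ᵥ R i ::ᵥ List.Vector.ofFn fun j => σ (ins j.succ) := by
            simp only [List.Vector.ofFn, Fin.cons_zero, Fin.cons_succ, ha, hb, hc]
          rw [this]
        · have := hins j
          rw [Function.update_of_ne (by omega),
            t2.eq_of_not_writes (by rw [writes_copy]; omega),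
            t1.eq_of_not_writes fun h => by rcases hG _ h with h | h <;> omega, hc])
      (fun τ hτ => by rw [hτ.1, hτ.2.2]; exact lt_irrefl _)
      (Nat.zero_le _) (σ := Function.update σ₁ fresh 0)
      ⟨by simp, by
        rw [Function.update_of_ne (by omega), h1']
        rfl, fun j => by
        rw [Function.update_of_ne (hins j).ne, hσ₁]⟩
    obtain ⟨σ₃, h3, h3'⟩ := exists_exec_copy (src := fresh + 1) (dst := out) (by omega) σ₂
    refine ⟨σ₃, .seq h1 (.seq (.zero _ _) (.seq h2 h3)), ?_⟩
    rw [h3', h2b]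
    simp only [List.Vector.ofFn, List.Vector.head_cons, List.Vector.tail_cons, R]

/-- Every primitive recursive function is computed by a program. -/
theorem exists_computes {n : ℕ} {f : List.Vector ℕ n → ℕ} (hf : Nat.Primrec' f) :
    ∀ (ins : Fin n → ℕ) (out fresh : ℕ), (∀ j, ins j < fresh) → out < fresh →
      (∀ j, ins j ≠ out) → ∃ P : Prog, P.Computes ins out fresh f := by
  induction hf with
  | zero =>
    exact fun ins out fresh _ _ _ => ⟨zero out, fun w hw => .inl hw,
      fun σ => ⟨_, .zero _ _, by simp⟩⟩
  | succ =>
    intro ins out fresh _ _ hne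
    refine ⟨seq (copy (ins 0) out) (inc out), ?_, fun σ => ?_⟩
    · rintro w (hw | hw)
      · exact .inl (writes_copy.1 hw)
      · exact .inl hw
    · obtain ⟨σ', h, h'⟩ := exists_exec_copy (hne 0) σ
      exact ⟨_, .seq h (.inc _ _), by simp [h', List.Vector.ofFn]⟩
  | get i =>
    intro ins out fresh _ _ hne
    refine ⟨copy (ins i) out, fun w hw => .inl (writes_copy.1 hw), fun σ => ?_⟩
    obtain ⟨σ', h, h'⟩ := exists_exec_copy (hne i) σ
    exact ⟨σ', h, by simp [h']⟩
  | @comp m n f g _ _ ihf ihg =>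
    intro ins out fresh hins hout hne
    obtain ⟨P, hP, hP'⟩ := exists_computes_family ihg hins n le_rfl
    obtain ⟨Q, hQ, hQ'⟩ := ihf (fun i => fresh + i) out (fresh + n)
      (fun j => by have := j.isLt; omega) (by omega) (fun j => by omega)
    refine ⟨seq P Q, ?_, fun σ => ?_⟩
    · rintro w (hw | hw)
      · exact .inr (hP w hw)
      · rcases hQ w hw with h | h
        · exact .inl h
        · exact .inr (by omega)
    · obtain ⟨σ₁, h1, h1'⟩ := hP' σ
      obtain ⟨σ₂, h2, h2'⟩ := hQ' σ₁
      refine ⟨σ₂, .seq h1 h2, ?_⟩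
      rw [h2']
      congr
      funext i
      exact h1' i i.isLt
  | prec _ _ ihf ihg => exact fun ins out fresh hins hout _ =>
      exists_computes_prec ihf ihg ins out fresh hins hout

/-! ### Compilation to register machine code -/

/-- The number of instructions of the compiled program. -/
def len : Prog → ℕ
  | inc _ => 1
  | zero _ => 1
  | seq P Q => P.len + Q.len
  | whileLt _ _ P => P.len + 2

/-- The instructions that carry out the program, to be placed from address `a` on. -/
def code : Prog → ℕ → List Instr
  | inc r, a => [.inc r (a + 1)]
  | zero r, a => [.zero r (a + 1)]
  | seq P Q, a => P.code a ++ Q.code (a + P.len)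
  -- The closing `jlt r r a a` is an unconditional jump back to the test, its two targets being
  -- equal.
  | whileLt r s P, a =>
    .jlt r s (a + 1) (a + P.len + 2) :: (P.code (a + 1) ++ [.jlt r r a a])

theorem length_code (P : Prog) (a : ℕ) : (P.code a).length = P.len := by
  induction P generalizing a with
  | inc | zero => rfl
  | seq P Q ihP ihQ => simp [code, len, ihP, ihQ]
  | whileLt r s P ih => simp [code, len, ih]

/-- The code of the program stands in `M` from address `a` on. -/
def LoadedAt (P : Prog) (M : List Instr) (a : ℕ) : Prop :=
  ∀ i < P.len, M[a + i]? = (P.code a)[i]?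

theorem LoadedAt.left {P Q : Prog} {M : List Instr} {a : ℕ} (h : (seq P Q).LoadedAt M a) :
    P.LoadedAt M a := fun i hi => by
  rw [h i (by simp only [len]; omega), code, List.getElem?_append_left (by rwa [length_code])]

theorem LoadedAt.right {P Q : Prog} {M : List Instr} {a : ℕ} (h : (seq P Q).LoadedAt M a) :
    Q.LoadedAt M (a + P.len) := fun i hi => by
  rw [add_assoc, h (P.len + i) (by simp only [len]; omega), code,
    List.getElem?_append_right (by rw [length_code]; omega), length_code, Nat.add_sub_cancel_left]

theorem LoadedAt.body {r s : ℕ} {P : Prog} {M : List Instr} {a : ℕ}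
    (h : (whileLt r s P).LoadedAt M a) : P.LoadedAt M (a + 1) := fun i hi => by
  rw [add_assoc, add_comm 1 i, h (i + 1) (by simp only [len]; omega), code,
    List.getElem?_cons_succ, List.getElem?_append_left (by rwa [length_code])]

theorem LoadedAt.machineStep_head {r s : ℕ} {P : Prog} {M : List Instr} {a : ℕ}
    (h : (whileLt r s P).LoadedAt M a) (σ : ℕ → ℕ) :
    machineStep M (a, σ) = (if σ r < σ s then a + 1 else a + P.len + 2, σ) := by
  have := h 0 (by simp [len])
  simp only [code, add_zero, List.getElem?_cons_zero] at this
  simp [machineStep, this]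

theorem LoadedAt.machineStep_back {r s : ℕ} {P : Prog} {M : List Instr} {a : ℕ}
    (h : (whileLt r s P).LoadedAt M a) (σ : ℕ → ℕ) :
    machineStep M (a + 1 + P.len, σ) = (a, σ) := by
  have := h (P.len + 1) (by simp [len])
  rw [code, List.getElem?_cons_succ, List.getElem?_append_right (by rw [length_code]), length_code,
    Nat.sub_self, List.getElem?_cons_zero, add_comm P.len, ← add_assoc] at this
  simp [machineStep, this]

/-- Induction on the execution works because the code is only assumed to be part of a larger `M`:
subprograms then run in the same machine at shifted addresses. -/
theorem Exec.machineStep_iterate {P : Prog} {σ σ' : ℕ → ℕ} (h : P.Exec σ σ') {M : List Instr}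
    {a : ℕ} (hM : P.LoadedAt M a) : ∃ j, (machineStep M)^[j] (a, σ) = (a + P.len, σ') := by
  induction h generalizing a with
  | inc r σ =>
    refine ⟨1, ?_⟩
    have := hM 0 (by simp [len])
    simp only [code, add_zero, List.getElem?_cons_zero] at this
    simp [machineStep, this, len]
  | zero r σ =>
    refine ⟨1, ?_⟩
    have := hM 0 (by simp [len])
    simp only [code, add_zero, List.getElem?_cons_zero] at this
    simp [machineStep, this, len]
  | seq _ _ ih1 ih2 =>
    obtain ⟨i, hi⟩ := ih1 hM.left
    obtain ⟨j, hj⟩ := ih2 hM.right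
    exact ⟨j + i, by rw [Function.iterate_add_apply, hi, hj, len, add_assoc]⟩
  | whileDone hlt => exact ⟨1, by simp [hM.machineStep_head, hlt, len, add_assoc]⟩
  | whileStep hlt _ _ ih1 ih2 =>
    obtain ⟨i, hi⟩ := ih1 hM.body
    obtain ⟨j, hj⟩ := ih2 hM
    refine ⟨j + (1 + (i + 1)), ?_⟩
    rw [Function.iterate_add_apply, Function.iterate_add_apply, Function.iterate_add_apply,
      Function.iterate_one, hM.machineStep_head, if_pos hlt, hi, hM.machineStep_back, hj]

/-- A loop whose condition stays true keeps the machine running. -/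
theorem LoadedAt.not_halts_of_loop {r s : ℕ} {P : Prog} {M : List Instr} {a : ℕ}
    (hM : (whileLt r s P).LoadedAt M a) (inv : (ℕ → ℕ) → Prop)
    (hinv : ∀ σ, inv σ → σ r < σ s ∧ ∃ σ', P.Exec σ σ' ∧ inv σ') (ha : a < M.length)
    {σ₀ σ : ℕ → ℕ} {i : ℕ} (hi : (machineStep M)^[i] (0, σ₀) = (a, σ)) (hσ : inv σ) :
    ¬ MachineHalts M σ₀ := by
  -- The loop head, an address inside `M`, is visited at arbitrarily late times, whereas a halted
  -- machine never moves again.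
  have key : ∀ k, ∃ j ≥ k, ∃ σ, (machineStep M)^[j] (0, σ₀) = (a, σ) ∧ inv σ := by
    intro k
    induction k with
    | zero => exact ⟨i, Nat.zero_le _, σ, hi, hσ⟩
    | succ k ih =>
      obtain ⟨j, hj, τ, hτ, hτ'⟩ := ih
      obtain ⟨hlt, τ', h1, h2⟩ := hinv τ hτ'
      obtain ⟨l, hl⟩ := h1.machineStep_iterate hM.body
      refine ⟨1 + (l + (1 + j)), by omega, τ', ?_, h2⟩
      rw [Function.iterate_add_apply, Function.iterate_add_apply, Function.iterate_add_apply, hτ,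
        Function.iterate_one, hM.machineStep_head, if_pos hlt, hl, hM.machineStep_back]
  rintro ⟨k, hk⟩
  obtain ⟨j, hj, τ, hτ, -⟩ := key k
  rw [← machineStep_iterate_of_length_le hj hk, hτ] at hk
  exact absurd ha (not_lt.2 hk)

end Prog

/-- The instruction changes the register. -/
def Instr.Writes : Instr → ℕ → Prop
  | .inc r _, w => w = r
  | .zero r _, w => w = r
  | .jlt .., _ => False

/-- All registers of the instruction have numbers less than `K`. -/
def Instr.RegsLt : Instr → ℕ → Prop
  | .inc r _, K => r < K
  | .zero r _, K => r < K
  | .jlt r s _ _, K => r < K ∧ s < K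

theorem Instr.RegsLt.mono {I : Instr} {K K' : ℕ} (h : I.RegsLt K) (hK : K ≤ K') :
    I.RegsLt K' := by
  cases I with
  | inc | zero => exact lt_of_lt_of_le h hK
  | jlt => exact ⟨h.1.trans_le hK, h.2.trans_le hK⟩

theorem exists_forall_regsLt (M : List Instr) : ∃ K, 0 < K ∧ ∀ I ∈ M, I.RegsLt K := by
  induction M with
  | nil => exact ⟨1, by simp⟩
  | cons I M ih =>
    obtain ⟨K, hK0, hK⟩ := ih
    obtain ⟨K', hK'⟩ : ∃ K', I.RegsLt K' := by
      cases I with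
      | inc r | zero r => exact ⟨r + 1, r.lt_succ_self⟩
      | jlt r s => exact ⟨r + s + 1, by simp only [Instr.RegsLt]; omega⟩
    refine ⟨K + K', by omega, fun J hJ => ?_⟩
    rcases List.mem_cons.1 hJ with rfl | hJ
    · exact hK'.mono (by omega)
    · exact (hK J hJ).mono (by omega)

theorem Prog.writes_of_mem_code {P : Prog} {a : ℕ} {I : Instr} (hI : I ∈ P.code a) {w : ℕ}
    (hw : I.Writes w) : P.Writes w := by
  induction P generalizing a with
  | inc | zero =>
    rw [List.mem_singleton.1 hI] at hw
    exact hw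
  | seq P Q ihP ihQ =>
    rcases List.mem_append.1 hI with h | h
    · exact .inl (ihP h)
    · exact .inr (ihQ h)
  | whileLt r s P ih =>
    simp only [code, List.mem_cons, List.mem_append, List.not_mem_nil, or_false] at hI
    rcases hI with rfl | h | rfl
    · exact hw.elim
    · exact ih h
    · exact hw.elim

/-! ### A machine with an undecidable halting problem -/

/-- Unbounded search for a zero of a primitive recursive function is carried out by a register
machine that keeps its input in register `0`. -/
theorem exists_machine_search {p : ℕ → ℕ → ℕ} (hp : Primrec₂ p) :
    ∃ M : List Instr, (∀ I ∈ M, ¬ I.Writes 0) ∧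
      ∀ n, MachineHalts M (Pi.single 0 n) ↔ ∃ k, p n k = 0 := by
  obtain ⟨P, hP, hP'⟩ := Prog.exists_computes (Nat.Primrec'.prim_iff₂.2 hp) ![0, 1] 2 4
    (by intro j; fin_cases j <;> simp) (by norm_num) (by intro j; fin_cases j <;> simp)
  have hrun : ∀ σ, ∃ σ', (Prog.seq P (.inc 1)).Exec σ σ' ∧ σ' 0 = σ 0 ∧ σ' 1 = σ 1 + 1 ∧
      σ' 2 = p (σ 0) (σ 1) ∧ σ' 3 = σ 3 := by
    intro σ
    obtain ⟨τ, h1, h2⟩ := hP' σ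
    have hne : ∀ w, w ≠ 2 → w < 4 → τ w = σ w := fun w hw hw' => h1.eq_of_not_writes fun h => by
      rcases hP w h with h | h <;> omega
    refine ⟨_, .seq h1 (.inc 1 τ), ?_, ?_, ?_, ?_⟩
    · simpa using hne 0 (by norm_num) (by norm_num)
    · simpa using hne 1 (by norm_num) (by norm_num)
    · simpa [List.Vector.ofFn] using h2
    · simpa using hne 3 (by norm_num) (by norm_num)
  -- Register `0` is the input, `1` the candidate `k`, `2` the last value of `p`, and `3` stays zero
  -- for the test. The initial `.inc 2` makes the loop run at least once.
  set W : Prog := .whileLt 3 2 (.seq P (.inc 1)) with hW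
  set Q : Prog := .seq (.inc 2) W with hQ
  have hload : Q.LoadedAt (Q.code 0) 0 := fun i _ => by rw [zero_add]
  have hlen : (Q.code 0).length = Q.len := Q.length_code 0
  refine ⟨Q.code 0, fun I hI hw => ?_, fun n => ⟨fun h => ?_, fun h => ?_⟩⟩
  · have := Prog.writes_of_mem_code hI hw
    simp only [hQ, hW, Prog.Writes] at this
    rcases this with h | h | h
    · omega
    · rcases hP _ h with h | h <;> omega
    · omega
  · by_contra hno
    push Not at hno
    obtain ⟨i, hi⟩ := (Prog.Exec.inc 2 (Pi.single 0 n)).machineStep_iterate hload.left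
    refine hload.right.not_halts_of_loop (fun σ => σ 0 = n ∧ σ 3 = 0 ∧ σ 2 ≠ 0) ?_ ?_ hi ?_ h
    · rintro σ ⟨h0, h3, h2⟩
      obtain ⟨σ', h, h0', -, h2', h3'⟩ := hrun σ
      refine ⟨by omega, σ', h, by omega, by omega, ?_⟩
      rw [h2', h0]
      exact hno _
    · rw [hlen]
      simp [hQ, hW, Prog.len]
    · simp
  · classical
    -- After `i > 0` rounds register `2` holds `p n (i - 1)`, so the least zero is noticed after
    -- `Nat.find h + 1` rounds.
    obtain ⟨σ', h1, -⟩ := Prog.exists_exec_whileLt (r := 3) (s := 2) (P := .seq P (.inc 1))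
      (n := Nat.find h + 1) (fun i σ => σ 0 = n ∧ σ 1 = i ∧ σ 3 = 0 ∧
        σ 2 = if i = 0 then 1 else p n (i - 1))
      (fun i hi σ hσ => by
        obtain ⟨h0, h1, h3, h2⟩ := hσ
        refine ⟨?_, ?_⟩
        · rw [h3, h2]
          split_ifs with hi0
          · exact one_pos
          · exact Nat.pos_of_ne_zero (Nat.find_min h (by omega))
        · obtain ⟨σ', h, h0', h1', h2', h3'⟩ := hrun σ
          exact ⟨σ', h, by omega, by omega, by omega, by simp [h2', h0, h1]⟩)
      (fun σ hσ => by simp [hσ.2.2.1, hσ.2.2.2, Nat.find_spec h])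
      (Nat.zero_le _)
      (σ := Function.update (Pi.single 0 n) 2 ((Pi.single 0 n : ℕ → ℕ) 2 + 1))
      (by simp)
    obtain ⟨j, hj⟩ := ((Prog.Exec.inc 2 _).seq h1).machineStep_iterate hload
    exact ⟨j, by rw [hj, hlen, zero_add]⟩

/-- Some register machine has an undecidable halting problem. -/
theorem exists_machine_undecidable : ∃ M : List Instr, (∀ I ∈ M, ¬ I.Writes 0) ∧
    ¬ ComputablePred fun n => MachineHalts M (Pi.single 0 n) := by
  -- The searched function vanishes at `k` exactly when the code with number `n`, run on input `0`
  -- with bound `k`, gives a result.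
  have hp : Primrec₂ fun n k : ℕ =>
      ((Nat.Partrec.Code.evaln k (Denumerable.ofNat Nat.Partrec.Code n) 0).elim 1 fun _ => 0) := by
    have h1 : Primrec fun x : ℕ × ℕ =>
        Nat.Partrec.Code.evaln x.2 (Denumerable.ofNat Nat.Partrec.Code x.1) 0 :=
      Nat.Partrec.Code.primrec_evaln.comp
        (((Primrec.snd).pair ((Primrec.ofNat _).comp Primrec.fst)).pair (Primrec.const 0))
    refine (Primrec.option_casesOn h1 (Primrec.const 1) (Primrec₂.const 0)).of_eq fun x => ?_
    dsimp only
    rcases Nat.Partrec.Code.evaln x.2 (Denumerable.ofNat Nat.Partrec.Code x.1) 0 <;> rfl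
  obtain ⟨M, hM, hM'⟩ := exists_machine_search hp
  refine ⟨M, hM, fun hdec => ComputablePred.halting_problem 0 ?_⟩
  have hred : (fun c : Nat.Partrec.Code => (c.eval 0).Dom) ≤₀
      fun n => MachineHalts M (Pi.single 0 n) := by
    refine ⟨Encodable.encode, Computable.encode, fun c => ?_⟩
    refine Part.dom_iff_mem.trans (Iff.trans ?_ (hM' _).symm)
    constructor
    · rintro ⟨x, hx⟩
      obtain ⟨k, hk⟩ := Nat.Partrec.Code.evaln_complete.1 hx
      exact ⟨k, by simp [Option.mem_def.1 hk]⟩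
    · rintro ⟨k, hk⟩
      rw [Denumerable.ofNat_encode] at hk
      rcases h : Nat.Partrec.Code.evaln k c 0 with _ | x
      · simp [h] at hk
      · exact ⟨x, Nat.Partrec.Code.evaln_sound h⟩
  exact ComputablePred.computable_of_manyOneReducible hred hdec

/-! ## Steps of the described systems -/

namespace LocationCode

/-- The delay interval has length one, so the uniform density on it is `1` and subintervals have
their length as probability. -/
theorem ofReal_le_delayDist {c : LocationCode} (hc : c.delayHi = c.delayLo + 1) {u v : ℝ≥0}
    (hu : (c.delayLo : ℝ) ≤ u) (hv : (v : ℝ) ≤ c.delayHi) :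
    ENNReal.ofReal (v - u) ≤ c.delayDist (Set.Icc u v) := by
  rw [delayDist, if_pos (by omega), Measure.map_apply measurable_real_toNNReal measurableSet_Icc,
    cond_apply measurableSet_Icc, Real.volume_Icc, hc]
  simp only [Nat.cast_add, Nat.cast_one, add_sub_cancel_left, ENNReal.ofReal_one, inv_one, one_mul]
  rw [← Real.volume_Icc]
  refine measure_mono fun x hx => ⟨⟨hu.trans hx.1, hx.2.trans (by simpa [hc] using hv)⟩, ?_⟩
  exact ⟨NNReal.le_toNNReal_of_coe_le hx.1, Real.toNNReal_le_iff_le_coe.2 hx.2⟩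

theorem ae_delayLo_le (c : LocationCode) : ∀ᵐ τ : ℝ≥0 ∂c.delayDist, (c.delayLo : ℝ) ≤ τ := by
  have hm : MeasurableSet {τ : ℝ≥0 | (c.delayLo : ℝ) ≤ τ} :=
    measurableSet_le measurable_const measurable_coe_nnreal_real
  rw [delayDist]
  split_ifs with h
  · rw [ae_map_iff measurable_real_toNNReal.aemeasurable hm]
    filter_upwards [ae_cond_mem measurableSet_Icc] with x hx
    exact hx.1.trans (Real.le_coe_toNNReal x)
  · rw [ae_dirac_iff hm]
    simp

theorem map_coe_delayDist_absolutelyContinuous {c : LocationCode} (hc : c.delayLo < c.delayHi) :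
    c.delayDist.map ((↑) : ℝ≥0 → ℝ) ≪ volume := by
  rw [delayDist, if_pos hc, Measure.map_map measurable_coe_nnreal_real measurable_real_toNNReal]
  have h : (((↑) : ℝ≥0 → ℝ) ∘ Real.toNNReal) =ᵐ[ProbabilityTheory.cond volume
      (Set.Icc (c.delayLo : ℝ) (c.delayHi : ℝ))] id := by
    filter_upwards [ae_cond_mem measurableSet_Icc] with x hx
    exact Real.coe_toNNReal x ((Nat.cast_nonneg _).trans hx.1)
  rw [Measure.map_congr h, Measure.map_id]
  exact cond_absolutelyContinuous

end LocationCode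

namespace SHSCode

variable {c : SHSCode}

/-- The value of the variable `i`, or `0` if there is no such variable. -/
def val (s : c.State) (i : ℕ) : ℝ := if h : i < c.numVars then s.2 ⟨i, h⟩ else 0

theorem measurable_val (i : ℕ) : Measurable fun s : c.State => val s i := by
  unfold val
  split_ifs
  · exact (measurable_pi_apply _).comp measurable_snd
  · exact measurable_const

/-- The state that an edge leads to. -/
def fire (s : c.State) (e : EdgeCode) : c.State := (c.toLoc e.tgt, e.resetMap c.numVars s.2)

/-- The edge may be taken in the state. -/
def Fireable (s : c.State) (e : EdgeCode) : Prop :=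
  s.1 = c.toLoc e.src ∧ s.2 ∈ e.guardSet c.numVars

theorem val_fire (s : c.State) (e : EdgeCode) (i : ℕ) :
    val (fire s e) i = if i ∈ e.resets then 0 else val s i := by
  simp only [val, fire, EdgeCode.resetMap]
  split_ifs <;> rfl

theorem val_after (s : c.State) (τ : ℝ≥0) {i : ℕ} (hi : i < c.numVars) :
    val (c.hybridSystem.after s τ) i =
      val s i + τ * (((c.locCode s.1).slopes.getD i 0 : ℤ) : ℝ) := by
  simp [val, hi, HybridSystem.after, hybridSystem]

theorem mem_guardSet {e : EdgeCode} (he : e.strict = false) (s : c.State) :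
    s.2 ∈ e.guardSet c.numVars ↔
      ∑ i ∈ Finset.range c.numVars, ((e.coeffs.getD i 0 : ℤ) : ℝ) * val s i ≤ e.bound := by
  have : ∑ i ∈ Finset.range c.numVars, ((e.coeffs.getD i 0 : ℤ) : ℝ) * val s i =
      ∑ i : Fin c.numVars, ((e.coeffs.getD i 0 : ℤ) : ℝ) * s.2 i := by
    rw [Finset.sum_range]
    exact Finset.sum_congr rfl fun i _ => by simp [val]
  rw [this, EdgeCode.guardSet, he]
  rfl

/-- The coefficients of a linear form in `n` variables that is given by its terms. -/
def coeffList (n : ℕ) (t : List (ℕ × ℤ)) : List ℤ :=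
  (List.range n).map fun i => (t.map fun p => if p.1 = i then p.2 else 0).sum

theorem sum_coeffList (s : c.State) (t : List (ℕ × ℤ)) :
    ∑ i ∈ Finset.range c.numVars, (((coeffList c.numVars t).getD i 0 : ℤ) : ℝ) * val s i =
      (t.map fun p => (p.2 : ℝ) * val s p.1).sum := by
  have h : ∀ i ∈ Finset.range c.numVars,
      (((coeffList c.numVars t).getD i 0 : ℤ) : ℝ) * val s i =
        (((t.map fun p => if p.1 = i then p.2 else 0).sum : ℤ) : ℝ) * val s i := by
    intro i hi
    simp [coeffList, List.getD_eq_getElem?_getD, Finset.mem_range.1 hi]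
  rw [Finset.sum_congr rfl h]
  induction t with
  | nil => simp
  | cons p t ih =>
    simp only [List.map_cons, List.sum_cons, Int.cast_add, add_mul, Finset.sum_add_distrib,
      Int.cast_ite, Int.cast_zero, ite_mul, zero_mul, Finset.sum_ite_eq, Finset.mem_range]
    rw [ih fun i hi => by simp [coeffList, List.getD_eq_getElem?_getD, Finset.mem_range.1 hi]]
    congr 1
    split_ifs with hp
    · rfl
    · simp [val, hp]

theorem step_toSHS_apply (h : c.NonBlocking) (s : c.State) {B : Set c.State}
    (hB : MeasurableSet B) : (c.toSHS h).step s B =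
      ∫⁻ τ, ∑ e, c.edgeProb (c.hybridSystem.after s τ) e *
        B.indicator 1 (fire (c.hybridSystem.after s τ) (c.edges.get e)) ∂c.delayKernel s := by
  rw [StochHybridSystem.step_apply _ s hB]
  refine lintegral_congr fun τ => Finset.sum_congr rfl fun e _ => ?_
  change _ * Kernel.deterministic _ ((c.edges.get e).measurable_resetMap c.numVars) _ _ = _
  rw [Kernel.deterministic_apply]
  exact congrArg _ (Measure.dirac_apply' _ (measurable_prodMk_left hB))

theorem enabled_iff_fireable (s : c.State) (e : c.Edge) :
    c.hybridSystem.Enabled s e ↔ Fireable s (c.edges.get e) := c.enabled_iff s e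

/-- If all edges that may be taken after a delay in `T` lead to `B`, then the next state is in `B`
with at least the probability of `T`. -/
theorem delayKernel_le_step (h : c.NonBlocking) (s : c.State) {B : Set c.State}
    (hB : MeasurableSet B) {T : Set ℝ≥0} (hT : MeasurableSet T)
    (hTB : ∀ τ ∈ T, ∀ e ∈ c.edges, Fireable (c.hybridSystem.after s τ) e →
      fire (c.hybridSystem.after s τ) e ∈ B) :
    c.delayKernel s T ≤ (c.toSHS h).step s B := by
  rw [step_toSHS_apply h s hB, ← lintegral_indicator_one hT]
  refine lintegral_mono_ae ?_
  filter_upwards [h s] with τ hτ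
  by_cases hτT : τ ∈ T
  · obtain ⟨e, s', s'', hd, hs⟩ := hτ
    rw [Set.indicator_of_mem hτT, Pi.one_apply,
      ← c.sum_edgeProb (c.hybridSystem.after s τ) ⟨e, s', hd.2 ▸ hs⟩]
    refine Finset.sum_le_sum fun e _ => ?_
    by_cases he : c.hybridSystem.Enabled (c.hybridSystem.after s τ) e
    · rw [Set.indicator_of_mem (hTB τ hτT _ (List.get_mem _ _) ((enabled_iff_fireable _ _).1 he)),
        Pi.one_apply, mul_one]
    · have := (c.edgeProb_pos_iff (c.hybridSystem.after s τ) e).not.2 he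
      simp [nonpos_iff_eq_zero.1 (not_lt.1 this)]
  · simp [hτT]

/-- If some edge that may be taken after any delay in `T` leads to `B`, then the next state is in
`B` with at least the probability of `T`, up to a factor that depends on the system only. -/
theorem inv_mul_delayKernel_le_step (h : c.NonBlocking) (s : c.State) {B : Set c.State}
    (hB : MeasurableSet B) {T : Set ℝ≥0} (hT : MeasurableSet T)
    (hTB : ∀ τ ∈ T, ∃ e ∈ c.edges, Fireable (c.hybridSystem.after s τ) e ∧
      fire (c.hybridSystem.after s τ) e ∈ B) :
    (c.edges.length : ℝ≥0∞)⁻¹ * c.delayKernel s T ≤ (c.toSHS h).step s B := by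
  classical
  rw [step_toSHS_apply h s hB, ← lintegral_indicator_const hT]
  refine lintegral_mono fun τ => ?_
  by_cases hτ : τ ∈ T
  swap
  · simp [hτ]
  rw [Set.indicator_of_mem hτ]
  obtain ⟨e, he, h1, h2⟩ := hTB τ hτ
  obtain ⟨i, rfl⟩ := List.mem_iff_get.1 he
  refine le_trans ?_ (Finset.single_le_sum (fun _ _ => zero_le) (Finset.mem_univ i))
  rw [Set.indicator_of_mem h2, Pi.one_apply, mul_one, edgeProb,
    if_pos ((enabled_iff_fireable _ _).2 h1)]
  refine ENNReal.inv_le_inv.2 ?_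
  calc _ ≤ ∑ _e' : c.Edge, (1 : ℝ≥0∞) := Finset.sum_le_sum fun _ _ => by split_ifs <;> simp
    _ = _ := by simp

end SHSCode

/-! ## A stochastic hybrid system that carries out a register machine

The variables `0` and `1` are local clocks, the difference of the variables `2` and `3` bounds the
total error, and the difference of the variables `2 * r + 4` and `2 * r + 5` approximates the
content of the register `r`. -/

section Construction

variable (M : List Instr) (K : ℕ)

/-- The slope of the variable `i` in the location `l`. -/
def machineSlope (l i : ℕ) : ℤ :=
  match M[l / 2]? with
  -- The first phase of an incrementation raises the budget, the second raises the register; every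
  -- other difference stays constant.
  | some (.inc r _) => if i = (if l % 2 = 0 then 2 else 2 * r + 4) then 2 else 1
  | _ => 1

/-- The location `2 * a` belongs to the instruction at address `a`; the location `2 * a + 1` is
used for the second phase of an incrementation. -/
def machineLoc (l : ℕ) : LocationCode where
  slopes := (List.range (2 * K + 4)).map (machineSlope M l)
  delayLo := l % 2
  delayHi := l % 2 + 1

/-- The edge that restarts the machine, keeping the register `0`. -/
def restartEdge (l : ℕ) : EdgeCode where
  src := l
  tgt := 0
  -- The empty linear form with bound `0` gives the guard `0 ≤ 0`, which always holds.
  coeffs := SHSCode.coeffList (2 * K + 4) []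
  strict := false
  bound := 0
  resets := (List.range (2 * K + 4)).filter fun i => i ≠ 4 ∧ i ≠ 5

/-- The edges for the instruction at address `a`. -/
def instrEdges (a : ℕ) : Instr → List EdgeCode
  -- The first guard says that the budget is at most `1/8`. At the second, clock `0` shows the delay
  -- `τ'` of the second phase and clock `1`, which was not reset in between, shows `τ + τ'`; so `2
  -- τ' - (τ + τ') ≤ 1` means `τ' ≤ 1 + τ`.
  | .inc _ a' =>
    [⟨2 * a, 2 * a + 1, SHSCode.coeffList (2 * K + 4) [(2, 8), (3, -8)], false, 1, [0]⟩,
     ⟨2 * a + 1, 2 * min a' M.length, SHSCode.coeffList (2 * K + 4) [(0, 2), (1, -1)], false, 1,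
      [0, 1]⟩]
  | .zero r a' =>
    [⟨2 * a, 2 * min a' M.length, SHSCode.coeffList (2 * K + 4) [], false, 0,
      [0, 1, 2 * r + 4, 2 * r + 5]⟩]
  -- With `x` and `y` the approximations of `r` and `s`, the guards are `x - y ≤ -1/2` and `y - x ≤
  -- 1/2`.
  | .jlt r s a' b' =>
    [⟨2 * a, 2 * min a' M.length, SHSCode.coeffList (2 * K + 4)
        [(2 * r + 4, 2), (2 * r + 5, -2), (2 * s + 4, -2), (2 * s + 5, 2)], false, -1, [0, 1]⟩,
     ⟨2 * a, 2 * min b' M.length, SHSCode.coeffList (2 * K + 4)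
        [(2 * s + 4, 2), (2 * s + 5, -2), (2 * r + 4, -2), (2 * r + 5, 2)], false, 1, [0, 1]⟩]

/-- The system that carries out the register machine `M`, whose registers are less than `K`. -/
def machineSHS : SHSCode where
  numVars := 2 * K + 4
  loc0 := machineLoc M K 0
  otherLocs := (List.range (2 * M.length)).map fun l => machineLoc M K (l + 1)
  edges := (List.range (2 * M.length + 1)).map (restartEdge K) ++
    (List.range M.length).flatMap fun a => M[a]?.elim [] (instrEdges M K a)

variable {M K}

open SHSCode

theorem mem_edges_machineSHS {e : EdgeCode} : e ∈ (machineSHS M K).edges ↔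
    (∃ l ≤ 2 * M.length, e = restartEdge K l) ∨
      ∃ a I, M[a]? = some I ∧ e ∈ instrEdges M K a I := by
  simp only [machineSHS, List.mem_append, List.mem_map, List.mem_range, List.mem_flatMap,
    Nat.lt_succ_iff, eq_comm (a := e)]
  refine or_congr Iff.rfl ⟨?_, ?_⟩
  · rintro ⟨a, ha, h⟩
    rw [List.getElem?_eq_getElem ha] at h
    exact ⟨a, M[a], List.getElem?_eq_getElem ha, h⟩
  · rintro ⟨a, I, ha, h⟩
    exact ⟨a, (List.getElem?_eq_some_iff.1 ha).1, by rwa [ha]⟩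

theorem length_otherLocs_machineSHS : (machineSHS M K).otherLocs.length = 2 * M.length := by
  simp [machineSHS]

theorem val_toLoc_machineSHS {k : ℕ} (hk : k ≤ 2 * M.length) :
    ((machineSHS M K).toLoc k : ℕ) = k := by
  have := length_otherLocs_machineSHS (M := M) (K := K)
  simp only [toLoc, Fin.ofNat]
  exact Nat.mod_eq_of_lt (by omega)

theorem loc_le_machineSHS (l : (machineSHS M K).Loc) : (l : ℕ) ≤ 2 * M.length := by
  have h := length_otherLocs_machineSHS (M := M) (K := K)
  have := l.isLt
  omega

theorem eq_toLoc_machineSHS {l : (machineSHS M K).Loc} {k : ℕ} (hk : k ≤ 2 * M.length) :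
    l = (machineSHS M K).toLoc k ↔ (l : ℕ) = k := by
  rw [Fin.ext_iff, val_toLoc_machineSHS hk]

theorem locCode_machineSHS (l : (machineSHS M K).Loc) :
    (machineSHS M K).locCode l = machineLoc M K l := by
  have key : ∀ (j : ℕ) (h : j < (machineLoc M K 0 ::
      (List.range (2 * M.length)).map fun l => machineLoc M K (l + 1)).length),
      (machineLoc M K 0 :: (List.range (2 * M.length)).map
        fun l => machineLoc M K (l + 1))[j] = machineLoc M K j := by
    intro j h
    cases j <;> simp
  exact key l l.isLt

theorem val_after_machineSHS (s : (machineSHS M K).State) (τ : ℝ≥0) {i : ℕ}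
    (hi : i < 2 * K + 4) : val ((machineSHS M K).hybridSystem.after s τ) i =
      val s i + τ * (machineSlope M s.1 i : ℝ) := by
  rw [val_after s τ hi, locCode_machineSHS]
  simp [machineLoc, List.getD_eq_getElem?_getD, hi]

theorem mem_guardSet_machineSHS {e : EdgeCode} (he : e.strict = false) {t : List (ℕ × ℤ)}
    (ht : e.coeffs = coeffList (2 * K + 4) t) (s : (machineSHS M K).State) :
    s.2 ∈ e.guardSet (machineSHS M K).numVars ↔
      (t.map fun p => (p.2 : ℝ) * val s p.1).sum ≤ e.bound := by
  rw [mem_guardSet he, ht]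
  exact iff_of_eq (congrArg (· ≤ (e.bound : ℝ)) (sum_coeffList s t))

theorem fireable_restartEdge (s : (machineSHS M K).State) :
    Fireable s (restartEdge K s.1) := by
  refine ⟨(eq_toLoc_machineSHS (loc_le_machineSHS _)).2 rfl, ?_⟩
  rw [mem_guardSet_machineSHS rfl rfl]
  simp [restartEdge]

theorem restartEdge_mem (s : (machineSHS M K).State) :
    restartEdge K s.1 ∈ (machineSHS M K).edges :=
  mem_edges_machineSHS.2 (.inl ⟨s.1, loc_le_machineSHS _, rfl⟩)

theorem src_instrEdges {a : ℕ} {I : Instr} {e : EdgeCode} (he : e ∈ instrEdges M K a I) :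
    e.src / 2 = a := by
  cases I <;> simp only [instrEdges, List.mem_cons, List.not_mem_nil, or_false] at he
  all_goals rcases he with rfl | rfl <;> dsimp only <;> omega

theorem eq_restartEdge_or_mem_instrEdges {s : (machineSHS M K).State} {e : EdgeCode}
    (he : e ∈ (machineSHS M K).edges) (hs : Fireable s e) :
    e = restartEdge K s.1 ∨ ∃ I, M[(s.1 : ℕ) / 2]? = some I ∧ e ∈ instrEdges M K (s.1 / 2) I ∧
      e.src = s.1 := by
  rcases mem_edges_machineSHS.1 he with ⟨l, hl, rfl⟩ | ⟨a, I, ha, hI⟩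
  · left
    rw [(eq_toLoc_machineSHS hl).1 hs.1]
  · right
    have h2 : e.src / 2 = a := src_instrEdges hI
    have hlt : a < M.length := (List.getElem?_eq_some_iff.1 ha).1
    have h := (eq_toLoc_machineSHS (by omega)).1 hs.1
    rw [h, h2]
    exact ⟨I, ha, hI, rfl⟩

/-! ### States that represent machine configurations -/

variable (n : ℕ)

/-- The machine is about to carry out the instruction at address `c.1` with the contents `c.2` of
the registers, and the error is at most `b`. -/
structure IsMain (c : ℕ × (ℕ → ℕ)) (b : ℝ) (s : (machineSHS M K).State) : Prop where
  -- All halting addresses are represented by the single location `2 * M.length`.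
  loc : (s.1 : ℕ) = 2 * min c.1 M.length
  clock0 : val s 0 = 0
  clock1 : val s 1 = 0
  le_bound : val s 2 - val s 3 ≤ b
  nonneg : 0 ≤ val s 2 - val s 3
  input : val s 4 - val s 5 = n
  error_le : ∀ r < K, |val s (2 * r + 4) - val s (2 * r + 5) - c.2 r| ≤ val s 2 - val s 3

/-- The machine is in the second phase of the incrementation at address `c.1`, for which an error
of at least `d` is admitted. -/
structure IsMid (c : ℕ × (ℕ → ℕ)) (b d : ℝ) (s : (machineSHS M K).State) : Prop where
  loc : (s.1 : ℕ) = 2 * c.1 + 1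
  clock0 : val s 0 = 0
  le_clock1 : d ≤ val s 1
  le_bound : val s 2 - val s 3 ≤ b
  -- Clock `1` shows the amount just added to the budget and not yet spent; the existing errors are
  -- bounded by the remainder.
  nonneg : 0 ≤ val s 2 - val s 3 - val s 1
  input : val s 4 - val s 5 = n
  error_le : ∀ r < K, |val s (2 * r + 4) - val s (2 * r + 5) - c.2 r| ≤
    val s 2 - val s 3 - val s 1

theorem measurableSet_isMain (c : ℕ × (ℕ → ℕ)) (b : ℝ) :
    MeasurableSet {s : (machineSHS M K).State | IsMain n c b s} := by
  have h : {s : (machineSHS M K).State | IsMain n c b s} =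
      (fun s => (s.1 : ℕ)) ⁻¹' {2 * min c.1 M.length} ∩ ({s | val s 0 = 0} ∩ ({s | val s 1 = 0} ∩
      ({s | val s 2 - val s 3 ≤ b} ∩ ({s | 0 ≤ val s 2 - val s 3} ∩
      ({s | val s 4 - val s 5 = n} ∩ ⋂ r, ⋂ (_ : r < K),
        {s | |val s (2 * r + 4) - val s (2 * r + 5) - c.2 r| ≤ val s 2 - val s 3}))))) := by
    ext s
    simp only [Set.mem_inter_iff, Set.mem_preimage, Set.mem_singleton_iff, Set.mem_ofPred_eq,
      Set.mem_iInter]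
    exact ⟨fun ⟨h1, h2, h3, h4, h5, h6, h7⟩ => ⟨h1, h2, h3, h4, h5, h6, h7⟩,
      fun ⟨h1, h2, h3, h4, h5, h6, h7⟩ => ⟨h1, h2, h3, h4, h5, h6, h7⟩⟩
  have hv := measurable_val (c := machineSHS M K)
  rw [h]
  refine .inter ?_ (.inter ?_ (.inter ?_ (.inter ?_ (.inter ?_ (.inter ?_ (.iInter fun r =>
    .iInter fun _ => ?_))))))
  · exact (measurable_from_top.comp measurable_fst) (measurableSet_singleton _)
  · exact measurableSet_eq_fun (hv _) measurable_const
  · exact measurableSet_eq_fun (hv _) measurable_const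
  · exact measurableSet_le ((hv _).sub (hv _)) measurable_const
  · exact measurableSet_le measurable_const ((hv _).sub (hv _))
  · exact measurableSet_eq_fun ((hv _).sub (hv _)) measurable_const
  · exact measurableSet_le (((hv _).sub (hv _)).sub measurable_const).abs ((hv _).sub (hv _))

theorem measurableSet_isMid (c : ℕ × (ℕ → ℕ)) (b d : ℝ) :
    MeasurableSet {s : (machineSHS M K).State | IsMid n c b d s} := by
  have h : {s : (machineSHS M K).State | IsMid n c b d s} =
      (fun s => (s.1 : ℕ)) ⁻¹' {2 * c.1 + 1} ∩ ({s | val s 0 = 0} ∩ ({s | d ≤ val s 1} ∩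
      ({s | val s 2 - val s 3 ≤ b} ∩ ({s | 0 ≤ val s 2 - val s 3 - val s 1} ∩
      ({s | val s 4 - val s 5 = n} ∩ ⋂ r, ⋂ (_ : r < K),
        {s | |val s (2 * r + 4) - val s (2 * r + 5) - c.2 r| ≤
          val s 2 - val s 3 - val s 1}))))) := by
    ext s
    simp only [Set.mem_inter_iff, Set.mem_preimage, Set.mem_singleton_iff, Set.mem_ofPred_eq,
      Set.mem_iInter]
    exact ⟨fun ⟨h1, h2, h3, h4, h5, h6, h7⟩ => ⟨h1, h2, h3, h4, h5, h6, h7⟩,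
      fun ⟨h1, h2, h3, h4, h5, h6, h7⟩ => ⟨h1, h2, h3, h4, h5, h6, h7⟩⟩
  have hv := measurable_val (c := machineSHS M K)
  rw [h]
  refine .inter ?_ (.inter ?_ (.inter ?_ (.inter ?_ (.inter ?_ (.inter ?_ (.iInter fun r =>
    .iInter fun _ => ?_))))))
  · exact (measurable_from_top.comp measurable_fst) (measurableSet_singleton _)
  · exact measurableSet_eq_fun (hv _) measurable_const
  · exact measurableSet_le measurable_const (hv _)
  · exact measurableSet_le ((hv _).sub (hv _)) measurable_const
  · exact measurableSet_le measurable_const (((hv _).sub (hv _)).sub (hv _))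
  · exact measurableSet_eq_fun ((hv _).sub (hv _)) measurable_const
  · exact measurableSet_le (((hv _).sub (hv _)).sub measurable_const).abs
      (((hv _).sub (hv _)).sub (hv _))

/-! ### Effect of the edges on representing states -/

variable {n}

/-- Only the exact input is needed to restart without any error: the variables of register `0` are
kept, and everything else is reset, including the budget. -/
theorem isMain_fire_restartEdge {s : (machineSHS M K).State} (hs : val s 4 - val s 5 = n)
    (hK : 0 < K) (l : ℕ) :
    IsMain n (0, Pi.single 0 n) 0 (fire s (restartEdge K l)) := by
  have hv : ∀ i, val (fire s (restartEdge K l)) i =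
      if i < 2 * K + 4 ∧ i ≠ 4 ∧ i ≠ 5 then 0 else val s i := by
    intro i
    rw [val_fire]
    simp [restartEdge]
  refine ⟨?_, ?_, ?_, ?_, ?_, ?_, fun r hr => ?_⟩
  · exact (val_toLoc_machineSHS (Nat.zero_le _)).trans (by simp)
  · rw [hv, if_pos (by omega)]
  · rw [hv, if_pos (by omega)]
  · rw [hv, hv, if_pos (by omega), if_pos (by omega), sub_zero]
  · rw [hv, hv, if_pos (by omega), if_pos (by omega), sub_zero]
  · rw [hv, hv, if_neg (by omega), if_neg (by omega), hs]
  · rcases Nat.eq_zero_or_pos r with rfl | hr0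
    · rw [hv, hv, hv, hv, if_neg (by omega), if_neg (by omega), if_pos (by omega),
        if_pos (by omega)]
      simp [hs]
    · rw [hv, hv, hv, hv, if_pos (by omega), if_pos (by omega), if_pos (by omega),
        if_pos (by omega)]
      simp [hr0.ne']

/-- No instruction increments register `0`, so its two variables have slope `1` in all locations.
This holds in all states, not only in those representing a configuration. -/
theorem val_after_input {s : (machineSHS M K).State} (hM : ∀ I ∈ M, ¬ I.Writes 0) (hK : 0 < K)
    (τ : ℝ≥0) : val ((machineSHS M K).hybridSystem.after s τ) 4 -
      val ((machineSHS M K).hybridSystem.after s τ) 5 = val s 4 - val s 5 := by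
  have h : ∀ l, machineSlope M l 4 = 1 ∧ machineSlope M l 5 = 1 := by
    intro l
    unfold machineSlope
    split
    · rename_i r a h
      have : r ≠ 0 := fun h0 => hM _ (List.mem_of_getElem? h) h0.symm
      constructor <;> split_ifs <;> first | rfl | omega
    · exact ⟨rfl, rfl⟩
  rw [val_after_machineSHS _ _ (by omega), val_after_machineSHS _ _ (by omega), (h _).1, (h _).2]
  ring

theorem IsMain.mono {c : ℕ × (ℕ → ℕ)} {b b' : ℝ} {s : (machineSHS M K).State}
    (hs : IsMain n c b s) (hb : b ≤ b') : IsMain n c b' s :=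
  { hs with le_bound := hs.le_bound.trans hb }

/-- The effect on the states of an edge that only resets the clocks and possibly a register. -/
theorem IsMain.fire_of_resets {c : ℕ × (ℕ → ℕ)} {b : ℝ} {s : (machineSHS M K).State}
    (hs : IsMain n c b s) {τ : ℝ≥0}
    (hslope : ∀ i, machineSlope M s.1 i = 1) {e : EdgeCode} {c' : ℕ × (ℕ → ℕ)}
    (hK : 0 < K) (htgt : e.tgt = 2 * min c'.1 M.length) (h0 : 0 ∈ e.resets) (h1 : 1 ∈ e.resets)
    (h2 : 2 ∉ e.resets) (h3 : 3 ∉ e.resets) (h4 : 4 ∉ e.resets) (h5 : 5 ∉ e.resets)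
    (hr : ∀ r < K, (2 * r + 4 ∈ e.resets ∧ 2 * r + 5 ∈ e.resets ∧ c'.2 r = 0) ∨
      (2 * r + 4 ∉ e.resets ∧ 2 * r + 5 ∉ e.resets ∧ c'.2 r = c.2 r)) :
    IsMain n c' b (fire ((machineSHS M K).hybridSystem.after s τ) e) := by
  have hv : ∀ i < 2 * K + 4, val ((machineSHS M K).hybridSystem.after s τ) i = val s i + τ := by
    intro i hi
    rw [val_after_machineSHS s τ hi, hslope]
    simp
  have hE : val (fire ((machineSHS M K).hybridSystem.after s τ) e) 2 -
      val (fire ((machineSHS M K).hybridSystem.after s τ) e) 3 = val s 2 - val s 3 := by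
    rw [val_fire, val_fire, if_neg h2, if_neg h3, hv _ (by omega), hv _ (by omega)]
    ring
  refine ⟨?_, ?_, ?_, ?_, ?_, ?_, fun r hrK => ?_⟩
  · rw [fire, val_toLoc_machineSHS (by omega), htgt]
  · rw [val_fire, if_pos h0]
  · rw [val_fire, if_pos h1]
  · rw [hE]; exact hs.le_bound
  · rw [hE]; exact hs.nonneg
  · rw [val_fire, val_fire, if_neg h4, if_neg h5, hv _ (by omega), hv _ (by omega), ← hs.input]
    ring
  · rw [hE, val_fire, val_fire]
    rcases hr r hrK with ⟨ha, hb, hc⟩ | ⟨ha, hb, hc⟩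
    · rw [if_pos ha, if_pos hb, hc]
      simpa using hs.nonneg
    · rw [if_neg ha, if_neg hb, hc, hv _ (by omega), hv _ (by omega), add_sub_add_right_eq_sub]
      exact hs.error_le r hrK

/-- Resetting both variables of a register makes its content exactly zero, at no cost to the budget
and after any delay. -/
theorem IsMain.zero {c : ℕ × (ℕ → ℕ)} {b : ℝ} {s : (machineSHS M K).State}
    (hs : IsMain n c b s) (hK : 0 < K) {r a : ℕ} (hI : M[c.1]? = some (.zero r a)) (hr : r ≠ 0)
    (τ : ℝ≥0) {e : EdgeCode} (he : e ∈ instrEdges M K c.1 (.zero r a)) :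
    IsMain n (machineStep M c) b (fire ((machineSHS M K).hybridSystem.after s τ) e) := by
  have hlt : c.1 < M.length := (List.getElem?_eq_some_iff.1 hI).1
  have hloc : (s.1 : ℕ) / 2 = c.1 := by rw [hs.loc]; omega
  rw [instrEdges, List.mem_singleton] at he
  subst he
  refine hs.fire_of_resets (fun i => ?_) hK ?_ ?_ ?_ ?_ ?_ ?_ ?_ fun q hq => ?_
  · simp [machineSlope, hloc, hI]
  · simp [machineStep, hI]
  iterate 2 simp
  iterate 4 simp; try omega
  · by_cases hqr : q = r
    · subst hqr
      simp [machineStep, hI]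
    · right
      simp only [machineStep, hI, List.mem_cons, List.not_mem_nil, or_false,
        Function.update_of_ne hqr, and_true]
      omega

/-- The difference of two approximations is off by at most `1/4`. The true difference is at most
`-1` or at least `0`, so one half separates the cases: the right guard holds and the wrong one
fails. Delays do not matter, all slopes being `1` here. -/
theorem IsMain.jlt {c : ℕ × (ℕ → ℕ)} {b : ℝ} {s : (machineSHS M K).State}
    (hs : IsMain n c b s) (hb : b ≤ 1 / 8) (hK : 0 < K) {r q a a' : ℕ}
    (hI : M[c.1]? = some (.jlt r q a a')) (hr : r < K) (hq : q < K)
    (τ : ℝ≥0) :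
    (∀ e ∈ instrEdges M K c.1 (.jlt r q a a'),
      Fireable ((machineSHS M K).hybridSystem.after s τ) e →
      IsMain n (machineStep M c) b (fire ((machineSHS M K).hybridSystem.after s τ) e)) ∧
    ∃ e ∈ instrEdges M K c.1 (.jlt r q a a'),
      Fireable ((machineSHS M K).hybridSystem.after s τ) e := by
  have hlt : c.1 < M.length := (List.getElem?_eq_some_iff.1 hI).1
  have hloc : (s.1 : ℕ) / 2 = c.1 := by rw [hs.loc]; omega
  have hslope : ∀ i, machineSlope M s.1 i = 1 := fun i => by simp [machineSlope, hloc, hI]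
  have hv : ∀ i < 2 * K + 4, val ((machineSHS M K).hybridSystem.after s τ) i = val s i + τ := by
    intro i hi
    rw [val_after_machineSHS s τ hi, hslope]
    simp
  have h1 := abs_le.1 (hs.error_le r hr)
  have h2 := abs_le.1 (hs.error_le q hq)
  have h3 := hs.le_bound
  have hsrc : ((machineSHS M K).hybridSystem.after s τ).1 = (machineSHS M K).toLoc (2 * c.1) :=
    (eq_toLoc_machineSHS (by omega)).2 (hs.loc.trans (by omega))
  have hfire : ∀ e ∈ instrEdges M K c.1 (.jlt r q a a'),
      e.tgt = 2 * min (if c.2 r < c.2 q then a else a') M.length →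
      IsMain n (machineStep M c) b (fire ((machineSHS M K).hybridSystem.after s τ) e) := by
    intro e he htgt
    have hres : e.resets = [0, 1] := by
      simp only [instrEdges, List.mem_cons, List.not_mem_nil, or_false] at he
      rcases he with rfl | rfl <;> rfl
    refine hs.fire_of_resets hslope hK ?_ ?_ ?_ ?_ ?_ ?_ ?_ fun q hq => .inr ?_
    · simpa [machineStep, hI] using htgt
    · simp [hres]
    · simp [hres]
    iterate 4 simp [hres]
    · simp [hres, machineStep, hI]
  rcases Nat.lt_or_ge (c.2 r) (c.2 q) with h | h
  · have hc : (c.2 r : ℝ) + 1 ≤ c.2 q := by exact_mod_cast h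
    rw [if_pos h] at hfire
    refine ⟨fun e he hg => ?_, ⟨_, List.mem_cons_self, hsrc, ?_⟩⟩
    · simp only [instrEdges, List.mem_cons, List.not_mem_nil, or_false] at he
      rcases he with rfl | rfl
      · exact hfire _ (by simp [instrEdges]) rfl
      · have hg2 := (mem_guardSet_machineSHS rfl rfl _).1 hg.2
        simp [hv, show 2 * r + 4 < 2 * K + 4 by omega, show 2 * r + 5 < 2 * K + 4 by omega,
          show 2 * q + 4 < 2 * K + 4 by omega, show 2 * q + 5 < 2 * K + 4 by omega] at hg2
        linarith
    · rw [mem_guardSet_machineSHS rfl rfl]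
      simp [hv, show 2 * r + 4 < 2 * K + 4 by omega, show 2 * r + 5 < 2 * K + 4 by omega,
          show 2 * q + 4 < 2 * K + 4 by omega, show 2 * q + 5 < 2 * K + 4 by omega]
      linarith
  · have hc : (c.2 q : ℝ) ≤ c.2 r := by exact_mod_cast h
    rw [if_neg (not_lt.2 h)] at hfire
    refine ⟨fun e he hg => ?_, ⟨_, List.mem_cons_of_mem _ List.mem_cons_self, hsrc, ?_⟩⟩
    · simp only [instrEdges, List.mem_cons, List.not_mem_nil, or_false] at he
      rcases he with rfl | rfl
      · have hg2 := (mem_guardSet_machineSHS rfl rfl _).1 hg.2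
        simp [hv, show 2 * r + 4 < 2 * K + 4 by omega, show 2 * r + 5 < 2 * K + 4 by omega,
          show 2 * q + 4 < 2 * K + 4 by omega, show 2 * q + 5 < 2 * K + 4 by omega] at hg2
        linarith
      · exact hfire _ (by simp [instrEdges]) rfl
    · rw [mem_guardSet_machineSHS rfl rfl]
      simp [hv, show 2 * r + 4 < 2 * K + 4 by omega, show 2 * r + 5 < 2 * K + 4 by omega,
          show 2 * q + 4 < 2 * K + 4 by omega, show 2 * q + 5 < 2 * K + 4 by omega]
      linarith

/-- The first phase of an incrementation. -/
theorem IsMain.inc {c : ℕ × (ℕ → ℕ)} {b : ℝ} {s : (machineSHS M K).State}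
    (hs : IsMain n c b s) (hK : 0 < K) {r a : ℕ} (hI : M[c.1]? = some (.inc r a))
    (τ : ℝ≥0) :
    (∀ e ∈ instrEdges M K c.1 (.inc r a), e.src = 2 * c.1 →
      Fireable ((machineSHS M K).hybridSystem.after s τ) e →
      IsMid n c (1 / 8) 0 (fire ((machineSHS M K).hybridSystem.after s τ) e)) ∧
    ∀ d : ℝ, 0 ≤ d → d / 2 ≤ τ → τ ≤ d → b + d ≤ 1 / 8 →
      ∃ e ∈ instrEdges M K c.1 (.inc r a),
        Fireable ((machineSHS M K).hybridSystem.after s τ) e ∧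
        IsMid n c (b + d) (d / 2) (fire ((machineSHS M K).hybridSystem.after s τ) e) := by
  have hlt : c.1 < M.length := (List.getElem?_eq_some_iff.1 hI).1
  have hloc : (s.1 : ℕ) = 2 * c.1 := by rw [hs.loc]; omega
  have hslope : ∀ i, machineSlope M s.1 i = if i = 2 then 2 else 1 := fun i => by
    simp [machineSlope, hloc, hI]
  have hv : ∀ i < 2 * K + 4, i ≠ 2 →
      val ((machineSHS M K).hybridSystem.after s τ) i = val s i + τ := by
    intro i hi hi2
    rw [val_after_machineSHS s τ hi, hslope, if_neg hi2]
    simp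
  have hv2 : val ((machineSHS M K).hybridSystem.after s τ) 2 = val s 2 + 2 * τ := by
    rw [val_after_machineSHS s τ (by omega), hslope]
    push_cast
    simp [mul_comm]
  have hsrc : ((machineSHS M K).hybridSystem.after s τ).1 = (machineSHS M K).toLoc (2 * c.1) :=
    (eq_toLoc_machineSHS (by omega)).2 hloc
  set e₁ : EdgeCode := ⟨2 * c.1, 2 * c.1 + 1, coeffList (2 * K + 4) [(2, 8), (3, -8)], false, 1,
    [0]⟩ with he₁
  have hmem : e₁ ∈ instrEdges M K c.1 (.inc r a) := List.mem_cons_self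
  -- Variable `2` has slope `2` and variable `3` slope `1`, so the delay adds exactly `τ` to the
  -- budget.
  have hguard : ((machineSHS M K).hybridSystem.after s τ).2 ∈ e₁.guardSet (machineSHS M K).numVars
      ↔ val s 2 - val s 3 + τ ≤ 1 / 8 := by
    rw [mem_guardSet_machineSHS rfl rfl]
    simp [hv2, hv 3 (by omega) (by omega), he₁]
    constructor <;> intro h <;> linarith
  have hmid : ∀ b' d' : ℝ, d' ≤ τ → val s 2 - val s 3 + τ ≤ b' →
      IsMid n c b' d' (fire ((machineSHS M K).hybridSystem.after s τ) e₁) := by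
    intro b' d' hd hb'
    have hf : ∀ i < 2 * K + 4, i ≠ 0 → i ≠ 2 →
        val (fire ((machineSHS M K).hybridSystem.after s τ) e₁) i = val s i + τ := by
      intro i hi hi0 hi2
      rw [val_fire, if_neg (by simpa [he₁] using hi0), hv i hi hi2]
    have hE : val (fire ((machineSHS M K).hybridSystem.after s τ) e₁) 2 = val s 2 + 2 * τ := by
      rw [val_fire, if_neg (by simp [he₁]), hv2]
    refine ⟨?_, ?_, ?_, ?_, ?_, ?_, fun q hq => ?_⟩
    · rw [fire, val_toLoc_machineSHS (by simp only [he₁]; omega)]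
    · rw [val_fire, if_pos (by simp [he₁])]
    · rw [hf 1 (by omega) (by omega) (by omega), hs.clock1]
      linarith
    · rw [hE, hf 3 (by omega) (by omega) (by omega)]
      linarith
    · rw [hE, hf 3 (by omega) (by omega) (by omega), hf 1 (by omega) (by omega) (by omega),
        hs.clock1]
      linarith [hs.nonneg]
    · rw [hf 4 (by omega) (by omega) (by omega), hf 5 (by omega) (by omega) (by omega), ← hs.input]
      ring
    · rw [hE, hf 3 (by omega) (by omega) (by omega), hf 1 (by omega) (by omega) (by omega),
        hf _ (by omega) (by omega) (by omega), hf _ (by omega) (by omega) (by omega), hs.clock1,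
        add_sub_add_right_eq_sub]
      linarith [hs.error_le q hq]
  refine ⟨fun e he hsrc' hg => ?_, fun d hd h1 h2 h3 => ⟨e₁, hmem, ⟨hsrc, hguard.2 ?_⟩,
    hmid _ _ h1 ?_⟩⟩
  · simp only [instrEdges, List.mem_cons, List.not_mem_nil, or_false] at he
    rcases he with rfl | rfl
    · exact hmid _ _ τ.2 (hguard.1 hg.2)
    · dsimp only at hsrc'
      omega
  · linarith [hs.le_bound]
  · linarith [hs.le_bound]

/-- The second phase of an incrementation. -/
theorem IsMid.inc {c : ℕ × (ℕ → ℕ)} {b d : ℝ} {s : (machineSHS M K).State}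
    (hs : IsMid n c b d s) (hK : 0 < K) {r a : ℕ} (hI : M[c.1]? = some (.inc r a)) (hr0 : r ≠ 0)
    {τ : ℝ≥0} (hτ : 1 ≤ (τ : ℝ)) :
    (∀ e ∈ instrEdges M K c.1 (.inc r a), e.src = 2 * c.1 + 1 →
      Fireable ((machineSHS M K).hybridSystem.after s τ) e →
      IsMain n (machineStep M c) b (fire ((machineSHS M K).hybridSystem.after s τ) e)) ∧
    (τ ≤ 1 + d → ∃ e ∈ instrEdges M K c.1 (.inc r a),
        Fireable ((machineSHS M K).hybridSystem.after s τ) e ∧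
        IsMain n (machineStep M c) b (fire ((machineSHS M K).hybridSystem.after s τ) e)) := by
  have hlt : c.1 < M.length := (List.getElem?_eq_some_iff.1 hI).1
  have hloc : (s.1 : ℕ) / 2 = c.1 := by rw [hs.loc]; omega
  have hslope : ∀ i, machineSlope M s.1 i = if i = 2 * r + 4 then 2 else 1 := fun i => by
    have : (s.1 : ℕ) % 2 = 1 := by rw [hs.loc]; omega
    simp [machineSlope, hloc, hI, this]
  have hv : ∀ i < 2 * K + 4, i ≠ 2 * r + 4 →
      val ((machineSHS M K).hybridSystem.after s τ) i = val s i + τ := by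
    intro i hi hi2
    rw [val_after_machineSHS s τ hi, hslope, if_neg hi2]
    simp
  have hsrc : ((machineSHS M K).hybridSystem.after s τ).1 =
      (machineSHS M K).toLoc (2 * c.1 + 1) := (eq_toLoc_machineSHS (by omega)).2 hs.loc
  set e₂ : EdgeCode := ⟨2 * c.1 + 1, 2 * min a M.length, coeffList (2 * K + 4) [(0, 2), (1, -1)],
    false, 1, [0, 1]⟩ with he₂
  have hmem : e₂ ∈ instrEdges M K c.1 (.inc r a) := List.mem_cons_of_mem _ List.mem_cons_self
  have hguard : ((machineSHS M K).hybridSystem.after s τ).2 ∈ e₂.guardSet (machineSHS M K).numVars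
      ↔ (τ : ℝ) ≤ 1 + val s 1 := by
    rw [mem_guardSet_machineSHS rfl rfl]
    simp [hv 0 (by omega) (by omega), hv 1 (by omega) (by omega), he₂, hs.clock0]
    constructor <;> intro h <;> linarith
  -- Together with `1 ≤ τ`, this puts the excess `τ - 1` of the incrementation between `0` and `val
  -- s 1`, the part of the budget set aside in the first phase.
  have hmain : (τ : ℝ) ≤ 1 + val s 1 →
      IsMain n (machineStep M c) b (fire ((machineSHS M K).hybridSystem.after s τ) e₂) := by
    intro hle
    have hf : ∀ i < 2 * K + 4, 1 < i → i ≠ 2 * r + 4 →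
        val (fire ((machineSHS M K).hybridSystem.after s τ) e₂) i = val s i + τ := by
      intro i hi hi0 hi2
      rw [val_fire, if_neg (by simp [he₂]; omega), hv i hi hi2]
    have hstep : machineStep M c = (a, Function.update c.2 r (c.2 r + 1)) := by
      simp [machineStep, hI]
    refine ⟨?_, ?_, ?_, ?_, ?_, ?_, fun q hq => ?_⟩
    · rw [fire, val_toLoc_machineSHS (by simp only [he₂]; omega), hstep]
    · rw [val_fire, if_pos (by simp [he₂])]
    · rw [val_fire, if_pos (by simp [he₂])]
    · rw [hf 2 (by omega) (by omega) (by omega), hf 3 (by omega) (by omega) (by omega)]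
      linarith [hs.le_bound]
    · rw [hf 2 (by omega) (by omega) (by omega), hf 3 (by omega) (by omega) (by omega)]
      linarith [hs.nonneg, hs.le_clock1]
    · rw [hf 4 (by omega) (by omega) (by omega), hf 5 (by omega) (by omega) (by omega), ← hs.input]
      ring
    · rw [hf 2 (by omega) (by omega) (by omega), hf 3 (by omega) (by omega) (by omega), hstep,
        hf (2 * q + 5) (by omega) (by omega) (by omega), add_sub_add_right_eq_sub]
      have habs := abs_le.1 (hs.error_le q hq)
      by_cases hqr : q = r
      · subst hqr
        have hq4 : val (fire ((machineSHS M K).hybridSystem.after s τ) e₂) (2 * q + 4) =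
            val s (2 * q + 4) + 2 * τ := by
          rw [val_fire, if_neg (by simp [he₂]), val_after_machineSHS s τ (by omega), hslope,
            if_pos rfl]
          push_cast
          ring
        rw [hq4]
        dsimp only
        rw [Function.update_self]
        push_cast
        exact abs_le.2 ⟨by linarith [hs.le_clock1], by linarith⟩
      · rw [hf (2 * q + 4) (by omega) (by omega) (by omega)]
        dsimp only
        rw [Function.update_of_ne hqr]
        exact abs_le.2 ⟨by linarith [hs.le_clock1], by linarith [hs.le_clock1]⟩
  refine ⟨fun e he hsrc' hg => ?_, fun h => ?_⟩
  · simp only [instrEdges, List.mem_cons, List.not_mem_nil, or_false] at he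
    rcases he with rfl | rfl
    · dsimp only at hsrc'
      omega
    · exact hmain (hguard.1 hg.2)
  · have hle : (τ : ℝ) ≤ 1 + val s 1 := h.trans (by linarith [hs.le_clock1])
    exact ⟨e₂, hmem, ⟨hsrc, hguard.2 hle⟩, hmain hle⟩

end Construction

/-! ## The reachability probability of the constructed system -/

section Correctness

open SHSCode

variable {M : List Instr} {K : ℕ}

/-- The restart edge of the current location may be taken after any delay. -/
theorem nonBlocking_machineSHS : (machineSHS M K).NonBlocking := by
  refine fun s => .of_forall fun τ => ?_
  obtain ⟨i, hi⟩ := List.mem_iff_get.1 (restartEdge_mem s)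
  have h := fireable_restartEdge ((machineSHS M K).hybridSystem.after s τ)
  obtain ⟨s', hs'⟩ := (enabled_iff_fireable ((machineSHS M K).hybridSystem.after s τ) i).2 <| by
    rw [hi]
    exact h
  exact ⟨i, s', _, ⟨fun _ _ => Set.mem_univ _, rfl⟩, hs'⟩

/-- The kernel of the constructed system. -/
abbrev machineKernel (M : List Instr) (K : ℕ) :
    Kernel (machineSHS M K).State (machineSHS M K).State :=
  ((machineSHS M K).toSHS nonBlocking_machineSHS).step

/-- The configuration of the machine after `j` steps on input `n`. -/
def machineConfig (M : List Instr) (n j : ℕ) : ℕ × (ℕ → ℕ) :=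
  (machineStep M)^[j] (0, Pi.single 0 n)

/-- The states that represent configurations of the machine on input `n`. -/
def runStates (M : List Instr) (K n : ℕ) : Set (machineSHS M K).State :=
  ⋃ j, {s | IsMain n (machineConfig M n j) (1 / 8) s} ∪
    -- Odd locations exist for all addresses but play a role in the simulation only for
    -- incrementations, hence this condition.
    ({_s | ∃ r a, M[(machineConfig M n j).1]? = some (.inc r a)} ∩
      {s | IsMid n (machineConfig M n j) (1 / 8) 0 s})

theorem measurableSet_runStates (n : ℕ) : MeasurableSet (runStates M K n) :=
  .iUnion fun _ => (measurableSet_isMain _ _ _).union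
    ((MeasurableSet.const _).inter (measurableSet_isMid _ _ _ _))

theorem isMain_mem_runStates {n j : ℕ} {s : (machineSHS M K).State}
    (hs : IsMain n (machineConfig M n j) (1 / 8) s) : s ∈ runStates M K n :=
  Set.mem_iUnion.2 ⟨j, .inl hs⟩

theorem input_of_mem_runStates {n : ℕ} {s : (machineSHS M K).State} (hs : s ∈ runStates M K n) :
    val s 4 - val s 5 = n := by
  obtain ⟨j, h | h⟩ := Set.mem_iUnion.1 hs
  exacts [h.input, h.2.input]

theorem restart_mem {n : ℕ} {s : (machineSHS M K).State} (hM : ∀ I ∈ M, ¬ I.Writes 0)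
    (hK : 0 < K) (hs : s ∈ runStates M K n) (τ : ℝ≥0) (l : ℕ) :
    IsMain n (machineConfig M n 0) 0
      (fire ((machineSHS M K).hybridSystem.after s τ) (restartEdge K l)) :=
  isMain_fire_restartEdge ((val_after_input hM hK τ).trans (input_of_mem_runStates hs)) hK l

/-- Every edge that can be taken either restarts or carries out the current instruction correctly
with budget at most `1/8`. The lower bound on the delay matters in second phases, where a delay
below `1` could make the register too small. -/
theorem fire_mem_runStates {n : ℕ} {s : (machineSHS M K).State} (hM : ∀ I ∈ M, ¬ I.Writes 0)
    (hMK : ∀ I ∈ M, I.RegsLt K) (hK : 0 < K) (hs : s ∈ runStates M K n) {τ : ℝ≥0}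
    (hτ : (((s.1 : ℕ) % 2 : ℕ) : ℝ) ≤ τ) {e : EdgeCode} (he : e ∈ (machineSHS M K).edges)
    (hf : Fireable ((machineSHS M K).hybridSystem.after s τ) e) :
    fire ((machineSHS M K).hybridSystem.after s τ) e ∈ runStates M K n := by
  rcases eq_restartEdge_or_mem_instrEdges he hf with rfl | ⟨I, hI, heI, hsrc⟩
  · exact isMain_mem_runStates ((restart_mem hM hK hs τ _).mono (by norm_num))
  · change M[(s.1 : ℕ) / 2]? = some I at hI
    change e ∈ instrEdges M K ((s.1 : ℕ) / 2) I at heI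
    change e.src = (s.1 : ℕ) at hsrc
    have hmem : I ∈ M := List.mem_of_getElem? hI
    have hlt : (s.1 : ℕ) / 2 < M.length := (List.getElem?_eq_some_iff.1 hI).1
    obtain ⟨j, h | ⟨⟨r, a, hr⟩, h⟩⟩ := Set.mem_iUnion.1 hs
    · have h : IsMain n (machineConfig M n j) (1 / 8) s := h
      have hloc : (s.1 : ℕ) = 2 * (machineConfig M n j).1 := by have := h.loc; omega
      rw [hloc, Nat.mul_div_cancel_left _ two_pos] at hI heI
      have hnext : machineStep M (machineConfig M n j) = machineConfig M n (j + 1) :=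
        (Function.iterate_succ_apply' _ _ _).symm
      cases I with
      | inc r a =>
        exact Set.mem_iUnion.2 ⟨j, .inr ⟨⟨r, a, hI⟩,
          (h.inc hK hI τ).1 e heI (hsrc.trans hloc) hf⟩⟩
      | zero r a =>
        refine isMain_mem_runStates (j := j + 1) ?_
        rw [← hnext]
        exact h.zero hK hI (fun h0 => hM _ hmem h0.symm) τ heI
      | jlt r q a a' =>
        refine isMain_mem_runStates (j := j + 1) ?_
        rw [← hnext]
        exact (h.jlt le_rfl hK hI (hMK _ hmem).1 (hMK _ hmem).2 τ).1 e heI hf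
    · have h : IsMid n (machineConfig M n j) (1 / 8) 0 s := h
      have hloc := h.loc
      rw [hloc, show (2 * (machineConfig M n j).1 + 1) / 2 = (machineConfig M n j).1 by omega]
        at hI heI
      obtain rfl : I = .inc r a := Option.some_inj.1 (hI.symm.trans hr)
      refine isMain_mem_runStates (j := j + 1) ?_
      rw [machineConfig, Function.iterate_succ_apply']
      refine (h.inc hK hI (fun h0 => hM _ hmem h0.symm) ?_).1 e heI (hsrc.trans hloc) hf
      rwa [show (s.1 : ℕ) % 2 = 1 by omega, Nat.cast_one] at hτ

theorem machineKernel_compl_runStates {n : ℕ} (hM : ∀ I ∈ M, ¬ I.Writes 0)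
    (hMK : ∀ I ∈ M, I.RegsLt K) (hK : 0 < K) {s : (machineSHS M K).State}
    (hs : s ∈ runStates M K n) : machineKernel M K s (runStates M K n)ᶜ = 0 := by
  rw [prob_compl_eq_zero_iff (measurableSet_runStates n)]
  refine le_antisymm prob_le_one ?_
  -- Invariance is available only for delays above the left end of the delay interval; these have
  -- probability one.
  have hT : MeasurableSet {τ : ℝ≥0 | (((s.1 : ℕ) % 2 : ℕ) : ℝ) ≤ τ} :=
    measurableSet_le measurable_const measurable_coe_nnreal_real
  have h1 : (machineSHS M K).delayKernel s {τ : ℝ≥0 | (((s.1 : ℕ) % 2 : ℕ) : ℝ) ≤ τ} = 1 := by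
    rw [← mem_ae_iff_prob_eq_one hT, delayKernel_apply, locCode_machineSHS]
    exact (machineLoc M K s.1).ae_delayLo_le
  rw [← h1]
  exact delayKernel_le_step _ s (measurableSet_runStates n) hT
    fun τ hτ e he hf => fire_mem_runStates hM hMK hK hs hτ he hf

/-- The states in the target location. -/
def haltStates (M : List Instr) (K : ℕ) : Set (machineSHS M K).State :=
  {s | s.1 = (machineSHS M K).toLoc (2 * M.length)}

theorem mem_haltStates {s : (machineSHS M K).State} :
    s ∈ haltStates M K ↔ (s.1 : ℕ) = 2 * M.length :=
  eq_toLoc_machineSHS le_rfl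

theorem measurableSet_haltStates : MeasurableSet (haltStates M K) :=
  measurable_fst (measurableSet_singleton _)

/-- One backward step of the lower bound: a suitable delay has probability at least `δ`, and a
suitable edge is then chosen with probability at least the inverse of the number of edges. The
resulting bound is uniform on `R`; the minimum with `1` is needed for `mul_le_hitWithin_succ`. -/
theorem exists_le_hitWithin_succ {R R' : Set (machineSHS M K).State} (hR' : MeasurableSet R')
    {T : Set ℝ≥0} (hT : MeasurableSet T) {δ : ℝ≥0∞} (hδ : δ ≠ 0)
    (hTδ : ∀ s ∈ R, δ ≤ (machineSHS M K).delayKernel s T)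
    (hstep : ∀ s ∈ R, ∀ τ ∈ T, ∃ e ∈ (machineSHS M K).edges,
      Fireable ((machineSHS M K).hybridSystem.after s τ) e ∧
      fire ((machineSHS M K).hybridSystem.after s τ) e ∈ R')
    {m : ℕ} {q : ℝ≥0∞} (hq : q ≠ 0)
    (hhit : ∀ s ∈ R', q ≤ hitWithin (machineKernel M K) (haltStates M K) m s) :
    ∃ q' : ℝ≥0∞, q' ≠ 0 ∧
      ∀ s ∈ R, q' ≤ hitWithin (machineKernel M K) (haltStates M K) (m + 1) s := by
  refine ⟨((machineSHS M K).edges.length : ℝ≥0∞)⁻¹ * δ * min q 1, ?_, fun s hs => ?_⟩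
  · refine mul_ne_zero (mul_ne_zero (ENNReal.inv_ne_zero.2 (ENNReal.natCast_ne_top _)) hδ) ?_
    exact (lt_min (pos_iff_ne_zero.2 hq) one_pos).ne'
  · refine mul_le_hitWithin_succ _ hR' (fun s hs => (min_le_left _ _).trans (hhit s hs))
      (min_le_right _ _) ?_
    refine le_trans ?_ (inv_mul_delayKernel_le_step _ s hR' hT (hstep s hs))
    gcongr
    exact hTδ s hs

theorem mem_edges_of_instr {a : ℕ} {I : Instr} (hI : M[a]? = some I) {e : EdgeCode}
    (he : e ∈ instrEdges M K a I) : e ∈ (machineSHS M K).edges :=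
  mem_edges_machineSHS.2 (.inr ⟨a, I, hI, he⟩)

/-- From the states that represent a configuration with error less than `1 / 8`, the target
location is reached with positive probability if the machine halts. -/
theorem exists_le_hitWithin {n : ℕ} (hM : ∀ I ∈ M, ¬ I.Writes 0) (hMK : ∀ I ∈ M, I.RegsLt K)
    (hK : 0 < K) (i : ℕ) {c : ℕ × (ℕ → ℕ)} {b : ℝ} (hb : b < 1 / 8)
    (hc : M.length ≤ ((machineStep M)^[i] c).1) :
    ∃ m, ∃ q : ℝ≥0∞, q ≠ 0 ∧ ∀ s ∈ {s : (machineSHS M K).State | IsMain n c b s},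
      q ≤ hitWithin (machineKernel M K) (haltStates M K) m s := by
  induction i generalizing c b with
  | zero =>
    refine ⟨0, 1, one_ne_zero, fun s (hs : IsMain n c b s) => ?_⟩
    rw [hitWithin_eq_one _ (mem_haltStates.2 (hs.loc.trans (congrArg _ (min_eq_right hc))))]
  | succ i ih =>
    rw [Function.iterate_succ_apply] at hc
    -- If there is no instruction, the machine has halted already and its step is the identity.
    rcases hI : M[c.1]? with _ | I
    · refine ih hb ?_
      rwa [show machineStep M c = c by simp [machineStep, hI]] at hc
    have hmem : I ∈ M := List.mem_of_getElem? hI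
    have hlt : c.1 < M.length := (List.getElem?_eq_some_iff.1 hI).1
    cases I with
    | zero r a =>
      obtain ⟨m, q, hq, hhit⟩ := ih hb hc
      refine ⟨m + 1, exists_le_hitWithin_succ (measurableSet_isMain _ _ _) .univ one_ne_zero
        (fun s _ => by simp) (fun s (hs : IsMain n c b s) τ _ => ?_) hq hhit⟩
      have he : _ ∈ instrEdges M K c.1 (.zero r a) := List.mem_singleton_self _
      refine ⟨_, mem_edges_of_instr hI he, ⟨?_, ?_⟩,
        hs.zero hK hI (fun h0 => hM _ hmem h0.symm) τ he⟩
      · exact (eq_toLoc_machineSHS (by dsimp only; omega)).2 (hs.loc.trans (by dsimp only; omega))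
      · rw [mem_guardSet_machineSHS rfl rfl]
        simp
    | jlt r p a a' =>
      obtain ⟨m, q, hq, hhit⟩ := ih hb hc
      refine ⟨m + 1, exists_le_hitWithin_succ (measurableSet_isMain _ _ _) .univ one_ne_zero
        (fun s _ => by simp) (fun s (hs : IsMain n c b s) τ _ => ?_) hq hhit⟩
      obtain ⟨h1, e, he, hf⟩ := hs.jlt hb.le hK hI (hMK _ hmem).1 (hMK _ hmem).2 τ
      exact ⟨e, mem_edges_of_instr hI he, hf, h1 e he hf⟩
    | inc r a =>
      -- Half of the remaining budget is spent, so that the strict bound survives for further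
      -- incrementations.
      obtain ⟨d, hd0, hd⟩ : ∃ d : ℝ, 0 < d ∧ b + d < 1 / 8 := ⟨(1 / 8 - b) / 2, by linarith,
        by linarith⟩
      by_cases hb0 : b < 0
      · exact ⟨0, 1, one_ne_zero, fun s (hs : IsMain n c b s) =>
          absurd (hs.nonneg.trans hs.le_bound) (not_le.2 hb0)⟩
      have hd1 : d ≤ 1 := by linarith [not_lt.1 hb0]
      lift d to ℝ≥0 using hd0.le
      have hδ : ENNReal.ofReal (d / 2 : ℝ) ≠ 0 := by simpa using hd0
      obtain ⟨m, q, hq, hhit⟩ := ih hd hc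
      obtain ⟨q', hq', hhit'⟩ : ∃ q' : ℝ≥0∞, q' ≠ 0 ∧
          ∀ s ∈ {s : (machineSHS M K).State | IsMid n c (b + d) (d / 2) s},
            q' ≤ hitWithin (machineKernel M K) (haltStates M K) (m + 1) s := by
        -- The first phase will set aside at least `d / 2`, so delays up to `1 + d / 2` satisfy the
        -- guard of the second phase.
        refine exists_le_hitWithin_succ (measurableSet_isMain _ _ _) (T := Set.Icc 1 (1 + d / 2))
          measurableSet_Icc hδ (fun s (hs : IsMid n c (b + d) (d / 2) s) => ?_)
          (fun s (hs : IsMid n c (b + d) (d / 2) s) τ hτ => ?_) hq hhit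
        · rw [delayKernel_apply, locCode_machineSHS]
          have h1 : (s.1 : ℕ) % 2 = 1 := by rw [hs.loc]; omega
          refine le_trans (le_of_eq ?_) ((machineLoc M K s.1).ofReal_le_delayDist rfl ?_ ?_)
          · push_cast
            congr 1
            ring
          · simp [machineLoc, h1]
          · push_cast
            simp only [machineLoc, h1]
            push_cast
            linarith
        · obtain ⟨e, he, h⟩ := (hs.inc hK hI (fun h0 => hM _ hmem h0.symm)
            (by exact_mod_cast hτ.1)).2 (by exact_mod_cast hτ.2)
          exact ⟨e, mem_edges_of_instr hI he, h⟩
      -- Delays in `[d / 2, d]` spend at most `d` and yet leave room for an interval of positive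
      -- length in the second phase.
      refine ⟨m + 1 + 1, exists_le_hitWithin_succ (measurableSet_isMid _ _ _ _)
        (T := Set.Icc (d / 2) d) measurableSet_Icc hδ (fun s (hs : IsMain n c b s) => ?_)
        (fun s (hs : IsMain n c b s) τ hτ => ?_) hq' hhit'⟩
      · rw [delayKernel_apply, locCode_machineSHS]
        have h0 : (s.1 : ℕ) % 2 = 0 := by rw [hs.loc]; omega
        refine le_trans (le_of_eq ?_) ((machineLoc M K s.1).ofReal_le_delayDist rfl ?_ ?_)
        · push_cast
          congr 1
          ring
        · simp only [machineLoc, h0, Nat.cast_zero]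
          positivity
        · simpa [machineLoc, h0] using hd1
      · obtain ⟨e, he, h⟩ := (hs.inc hK hI τ).2 d hd0.le (by exact_mod_cast hτ.1)
          (by exact_mod_cast hτ.2) hd.le
        exact ⟨e, mem_edges_of_instr hI he, h⟩

/-- If the machine halts, a restart leads from any state of `runStates` to the initial configuration
with budget `0`, from where halting has uniformly positive probability. If it does not halt, no
state of `runStates` is in the target location. -/
theorem reachProb_machineKernel {n : ℕ} (hM : ∀ I ∈ M, ¬ I.Writes 0)
    (hMK : ∀ I ∈ M, I.RegsLt K) (hK : 0 < K) {s : (machineSHS M K).State}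
    (hs : IsMain n (0, Pi.single 0 n) 0 s) :
    (MachineHalts M (Pi.single 0 n) →
      reachProb (machineKernel M K) (Measure.dirac s) (haltStates M K) = 1) ∧
    (¬ MachineHalts M (Pi.single 0 n) →
      reachProb (machineKernel M K) (Measure.dirac s) (haltStates M K) = 0) := by
  have h0 : ∀ᵐ s' ∂Measure.dirac s, s' ∈ runStates M K n :=
    (ae_dirac_iff (measurableSet_runStates n)).2
      (isMain_mem_runStates (j := 0) (hs.mono (by norm_num)))
  have hstep : ∀ s ∈ runStates M K n, machineKernel M K s (runStates M K n)ᶜ = 0 :=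
    fun s hs => machineKernel_compl_runStates hM hMK hK hs
  refine ⟨fun ⟨i, hi⟩ => ?_, fun h => ?_⟩
  · obtain ⟨m, q, hq, hhit⟩ := exists_le_hitWithin (n := n) hM hMK hK i (b := 0) (by norm_num) hi
    obtain ⟨q', hq', hhit'⟩ := exists_le_hitWithin_succ (R := runStates M K n)
      (measurableSet_isMain _ _ _) .univ one_ne_zero (fun s _ => by simp)
      (fun s hs τ _ => ⟨_, restartEdge_mem s,
        fireable_restartEdge ((machineSHS M K).hybridSystem.after s τ),
        restart_mem hM hK hs τ _⟩) hq hhit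
    exact reachProb_eq_one_of_hitWithin _ _ measurableSet_haltStates (measurableSet_runStates n)
      h0 hstep hq' hhit'
  · refine reachProb_eq_zero_of_disjoint _ _ (measurableSet_runStates n) h0 hstep ?_
    rw [Set.disjoint_left]
    intro s hs ht
    rw [mem_haltStates] at ht
    obtain ⟨j, h1 | ⟨-, h1⟩⟩ := Set.mem_iUnion.1 hs
    · have h1 : IsMain n (machineConfig M n j) (1 / 8) s := h1
      refine h ⟨j, ?_⟩
      have := h1.loc
      change M.length ≤ (machineConfig M n j).1
      omega
    -- Second phases happen in odd locations, while the target location is even.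
    · have h1 : IsMid n (machineConfig M n j) (1 / 8) 0 s := h1
      have := h1.loc
      omega

end Correctness

/-! ## Undecidability -/

section Undecidability

open SHSCode

/-- The input of the reachability problems that belongs to the register machine `M` with input
`n`. -/
def machineReachCode (M : List Instr) (K n : ℕ) : ReachCode where
  system := machineSHS M K
  initLoc := 0
  initVal := [0, 0, 0, 0, (n : ℤ)]
  target := 2 * M.length

theorem machineSlope_pos (M : List Instr) (l i : ℕ) : 0 < machineSlope M l i := by
  unfold machineSlope
  split
  · split_ifs <;> norm_num
  · norm_num

theorem map_coe_delayDist_machineSHS {M : List Instr} {K : ℕ} (l : (machineSHS M K).Loc) :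
    ((machineSHS M K).locCode l).delayDist.map ((↑) : ℝ≥0 → ℝ) ≪ volume := by
  rw [locCode_machineSHS]
  exact LocationCode.map_coe_delayDist_absolutelyContinuous (Nat.lt_succ_self _)

theorem getD_slopes_machineSHS {M : List Instr} {K : ℕ} (l : (machineSHS M K).Loc) {i : ℕ}
    (hi : i < 2 * K + 4) : ((machineSHS M K).locCode l).slopes.getD i 0 =
      ((machineSlope M l i).toNat : ℤ) := by
  rw [locCode_machineSHS, Int.toNat_of_nonneg (machineSlope_pos M l i).le]
  simp [machineLoc, List.getD_eq_getElem?_getD, hi]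

/-- The instance of the reachability problems that belongs to the register machine `M` with input
`n`. -/
def machineReachInstance (M : List Instr) (K n : ℕ) : ReachInstance where
  code := machineReachCode M K n
  nonBlocking := nonBlocking_machineSHS
  purelyContinuous s := map_coe_delayDist_machineSHS s.1
  linearGuards e := by
    refine ⟨fun i => ((machineSHS M K).edges.get e).coeffs.getD i 0,
      ((machineSHS M K).edges.get e).bound, ?_⟩
    change ((machineSHS M K).edges.get e).guardSet _ = _ ∨
      ((machineSHS M K).edges.get e).guardSet _ = _
    unfold EdgeCode.guardSet
    split_ifs
    · exact .inl rfl
    · exact .inr rfl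
  positiveIntegerSlopes l := by
    refine ⟨fun i => (machineSlope M l i).toNat,
      fun i => Int.lt_toNat.2 (machineSlope_pos M l i), fun v τ => funext fun i => ?_⟩
    change v i + (τ : ℝ) * ((((machineSHS M K).locCode l).slopes.getD i 0 : ℤ) : ℝ) = _
    exact congrArg (fun z : ℤ => v i + (τ : ℝ) * (z : ℝ)) (getD_slopes_machineSHS l i.isLt)

theorem isMain_init (M : List Instr) {K : ℕ} (hK : 0 < K) (n : ℕ) :
    IsMain n (0, Pi.single 0 n) 0 (machineReachInstance M K n).init := by
  have hv : ∀ i < 2 * K + 4, val (c := machineSHS M K) (machineReachInstance M K n).init i =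
      if i = 4 then (n : ℝ) else 0 := by
    intro i hi
    have : val (c := machineSHS M K) (machineReachInstance M K n).init i =
        ((([0, 0, 0, 0, (n : ℤ)] : List ℤ).getD i 0 : ℤ) : ℝ) := dif_pos hi
    rw [this]
    rcases lt_or_ge i 5 with h | h
    · interval_cases i <;> simp
    · rw [List.getD_eq_default _ _ (by simpa using h), if_neg (by omega), Int.cast_zero]
  refine ⟨?_, ?_, ?_, ?_, ?_, ?_, fun r hr => ?_⟩
  · exact (val_toLoc_machineSHS (Nat.zero_le _)).trans (by simp)
  · simp [hv 0 (by omega)]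
  · simp [hv 1 (by omega)]
  · simp [hv 2 (by omega), hv 3 (by omega)]
  · simp [hv 2 (by omega), hv 3 (by omega)]
  · simp [hv 4 (by omega), hv 5 (by omega)]
  · rw [hv 2 (by omega), hv 3 (by omega), hv _ (by omega), hv _ (by omega),
      if_neg (by omega : ¬ 2 * r + 5 = 4)]
    rcases Nat.eq_zero_or_pos r with rfl | hr0
    · simp
    · simp [hr0.ne']

/-! ### Computability of the test against one half -/

theorem encode_intCast (n : ℕ) : Encodable.encode (n : ℤ) = 2 * n := rfl

theorem encode_negSucc (n : ℕ) : Encodable.encode (Int.negSucc n) = 2 * n + 1 := rfl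

/-- The integer must be nonnegative, which is the evenness of its encoding, and its double is then
the encoding itself. This reduces the test to arithmetic of natural numbers. -/
theorem primrecPred_lt_two_mul : PrimrecPred fun x : ℤ × ℕ => (x.2 : ℤ) + 1 < 2 * x.1 := by
  have henc : Primrec fun x : ℤ × ℕ => Encodable.encode x.1 := Primrec.encode.comp Primrec.fst
  refine ((Primrec.eq.comp (Primrec.nat_mod.comp henc (.const 2)) (.const 0)).and
    (Primrec.nat_lt.comp (Primrec.succ.comp Primrec.snd) henc)).of_eq fun x => ?_
  obtain ⟨a | a, b⟩ := x
  · rw [Int.ofNat_eq_natCast, encode_intCast]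
    dsimp only
    omega
  · rw [encode_negSucc]
    dsimp only
    omega

/-- There is a family of instances, computable from a natural number, whose reachability
probabilities are `0` or `1`, and for which it is undecidable which of them it is. -/
theorem exists_undecidable_family : ∃ F : ℕ → ReachInstance,
    Computable (fun n => (F n).code) ∧ (∀ n, (F n).prob = 0 ∨ (F n).prob = 1) ∧
    ¬ ComputablePred fun n => (F n).prob = 1 := by
  obtain ⟨M, hM, hund⟩ := exists_machine_undecidable
  obtain ⟨K, hK, hMK⟩ := exists_forall_regsLt M
  have hprob : ∀ n, (MachineHalts M (Pi.single 0 n) → (machineReachInstance M K n).prob = 1) ∧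
      (¬ MachineHalts M (Pi.single 0 n) → (machineReachInstance M K n).prob = 0) :=
    fun n => reachProb_machineKernel hM hMK hK (isMain_init M hK n)
  refine ⟨machineReachInstance M K, ?_, fun n => ?_, fun hdec => hund (hdec.of_eq fun n => ?_)⟩
  · have hcast : Primrec (fun n : ℕ => (n : ℤ)) :=
      Primrec.encode_iff.1 (Primrec.nat_double.of_eq fun n => (encode_intCast n).symm)
    have hinit : Primrec fun n : ℕ => ([0, 0, 0, 0, (n : ℤ)] : List ℤ) :=
      Primrec.list_cons.comp (.const 0) <| Primrec.list_cons.comp (.const 0) <|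
        Primrec.list_cons.comp (.const 0) <| Primrec.list_cons.comp (.const 0) <|
        Primrec.list_cons.comp hcast (.const [])
    exact ((Primrec.of_equiv_symm (e := _)).comp ((Primrec.const (machineSHS M K)).pair
      ((Primrec.const 0).pair (hinit.pair (Primrec.const (2 * M.length)))))).to_comp
  · by_cases h : MachineHalts M (Pi.single 0 n)
    · exact .inr ((hprob n).1 h)
    · exact .inl ((hprob n).2 h)
  · by_cases h : MachineHalts M (Pi.single 0 n)
    · simp [h, (hprob n).1 h]
    · simp [h, (hprob n).2 h]

/-- The algorithm may diverge on data that present no input, but along a computable family of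
genuine inputs it is total. -/
theorem DecidableProblem.computablePred {ι α : Type} [Primcodable α] {enc : ι → α} {P : ι → Prop}
    (h : DecidableProblem enc P) {F : ℕ → ι} (hF : Computable fun n => enc (F n)) :
    ComputablePred fun n => P (F n) := by
  obtain ⟨f, hf, hfP⟩ := h
  refine ComputablePred.computable_iff.2 ?_
  choose b hb hbP using hfP
  refine ⟨fun n => b (F n), (hf.comp hF).of_eq fun n => Part.eq_some_iff.2 (hb (F n)), ?_⟩
  funext n
  exact propext (hbP (F n)).symm

end Undecidability

end

theorem mainTheorem5 :
    -- the qualitative problems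
    ¬ DecidableProblem ReachInstance.code (fun I => I.prob = 1) ∧
    ¬ DecidableProblem ReachInstance.code (fun I => I.prob = 0) ∧
    -- the approximate quantitative problem, where the input contains `ε > 0` and `p`
    ¬ DecidableProblem
      (fun x : {x : ReachInstance × (ℤ × ℕ) × (ℤ × ℕ) // 0 < ratOfPair x.2.1} =>
        (x.1.1.code, x.1.2))
      (fun x => |x.1.1.prob - (ratOfPair x.1.2.2 : ℝ)| < (ratOfPair x.1.2.1 : ℝ)) ∧
    -- the approximate quantitative problem for a fixed precision, as a decision problem with
    -- input `p`, and as the problem of computing an approximation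
    ∀ ε : ℝ, 0 < ε → ε < 1 / 2 →
      ¬ DecidableProblem (fun x : ReachInstance × (ℤ × ℕ) => (x.1.code, x.2))
        (fun x => |x.1.prob - (ratOfPair x.2 : ℝ)| < ε) ∧
      ¬ ApproximableWithin ε := by
  obtain ⟨F, hF, h01, hund⟩ := exists_undecidable_family
  have hone : (ratOfPair (1, 0) : ℝ) = 1 := by norm_num [ratOfPair]
  -- With `p = 1`, the approximate problems become the question whether the probability is `1`, by
  -- the zero-one gap.
  have hclose : ∀ ε : ℝ, 0 < ε → ε < 1 → ∀ n, |(F n).prob - 1| < ε ↔ (F n).prob = 1 := by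
    intro ε h0 h1 n
    rcases h01 n with h | h
    · simp [h, h1.le]
    · simp [h, h0]
  refine ⟨fun h => hund (h.computablePred hF), fun h => hund ?_, fun h => hund ?_,
    fun ε hε0 hε => ⟨fun h => hund ?_, fun ⟨f, hf, hfq⟩ => hund ?_⟩⟩
  · refine (h.computablePred hF).not.of_eq fun n => ?_
    rcases h01 n with h | h <;> simp [h]
  · have hhalf : ratOfPair (1, 1) = 1 / 2 := by norm_num [ratOfPair]
    refine (h.computablePred (F := fun n => ⟨(F n, (1, 1), (1, 0)), by norm_num [ratOfPair]⟩)
      (hF.pair (.const _))).of_eq fun n => ?_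
    dsimp only
    rw [hone, hhalf]
    exact hclose _ (by norm_num) (by norm_num) n
  · refine (h.computablePred (F := fun n => (F n, (1, 0))) (hF.pair (.const _))).of_eq fun n => ?_
    dsimp only
    rw [hone]
    exact hclose ε hε0 (by linarith) n
  · choose q hq hqε using hfq
    have hcomp : Computable fun n => q (F n) :=
      (hf.comp hF).of_eq fun n => Part.eq_some_iff.2 (hq (F n))
    -- As `ε < 1/2`, the computed approximation exceeds `1/2` exactly when the probability is `1`;
    -- for `a / (b + 1)` this is the condition `b + 1 < 2 * a`.
    refine (ComputablePred.computable_of_manyOneReducible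
      (p := fun n => ((q (F n)).2 : ℤ) + 1 < 2 * (q (F n)).1) ⟨_, hcomp, fun n => Iff.rfl⟩
      primrecPred_lt_two_mul.computablePred).of_eq fun n => ?_
    have hb : (0 : ℝ) < ((q (F n)).2 : ℝ) + 1 := by positivity
    have hr : (ratOfPair (q (F n)) : ℝ) = (q (F n)).1 / (((q (F n)).2 : ℝ) + 1) := by
      simp [ratOfPair]
    have hiff : ((q (F n)).2 : ℤ) + 1 < 2 * (q (F n)).1 ↔ 1 / 2 < (ratOfPair (q (F n)) : ℝ) := by
      rw [hr, lt_div_iff₀ hb, ← Int.cast_lt (R := ℝ)]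
      push_cast
      constructor <;> intro h <;> linarith
    rw [hiff]
    have habs := abs_le.1 (hqε (F n))
    rcases h01 n with h | h
    · rw [h] at habs ⊢
      simp only [zero_ne_one, iff_false, not_lt]
      linarith
    · rw [h] at habs ⊢
      simp only [iff_true]
      linarith
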